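/- **(Four not all small.)** There is a neighbourhood $U$ of the identity in the isometry group $\mathrm{Isom}(\mathbb H^3)$ (with the compact-open topology) such that, whenever $A,B\in\mathrm{Isom}(\mathbb H^3)$ generate a discrete non-elementary group (non-elementary: without an abelian subgroup of finite index), at least one of the four isometries $A$, $B$, $AB$, $AB^{-1}$ is not conjugate in $\mathrm{Isom}(\mathbb H^3)$ to an element of $U$. **(Four curves not all short.)** There is an $\varepsilon>0$ with the following property. Let $\bar S$ be a compact connected oriented surface of negative Euler characteristic and let its interior $S$ carry a complete hyperbolic metric of finite area. Let $\alpha,\beta$ be simple closed curves on $S$ that meet in exactly one point $p$ and have geometric intersection number $i(\alpha,\beta)=1$; here $i(\alpha,\beta)$ is the number of intersection points of the simple closed geodesics freely homotopic to $\alpha$ and $\beta$, and is $0$ if these geodesics coincide. Let $N\in AH(\bar S\times I,\partial\bar S\times I)$, that is, $N=\mathbb H^3/\rho(\pi_1(S))$ is a complete oriented hyperbolic $3$-manifold marked by a discrete faithful representation $\rho$ of $\pi_1(S)$ in the group of orientation-preserving isometries of $\mathbb H^3$ that takes every non-trivial peripheral element to a parabolic. For a closed curve $\gamma$ on $S$ let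 $\ell_N(\gamma)=\inf_{x\in\mathbb H^3}d(x,\rho(\gamma)x)$, which is the length of the closed geodesic of $N$ in the free homotopy class of $\gamma$, or $0$ if that class is parabolic. Then at least one of $\ell_N(\alpha)$, $\ell_N(\beta)$, $\ell_N(\alpha\beta)$, $\ell_N(\alpha\beta^{-1})$ is greater than $\varepsilon$, where $\alpha\beta$ and $\alpha\beta^{-1}$ are products of loops based at $p$; up to free homotopy they are the two simple curves obtained by cutting and pasting $\alpha$ and $\beta$ at $p$. -/

import Mathlib

open scoped UpperHalfPlane MatrixGroups Topology unitInterval ComplexConjugate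

/-! ### Hyperbolic 3-space and its isometries -/

/-- Hyperbolic 3-space, in the upper half-space model: the points `(z, t)` of `ℂ × ℝ` with
`t > 0`. -/
@[ext]
structure H3 where
  z : ℂ
  t : ℝ
  pos : 0 < t

namespace H3

/-- The point `(z, t)` in the Euclidean space `ℂ × ℝ`. -/
noncomputable def toE (x : H3) : WithLp 2 (ℂ × ℝ) := WithLp.toLp 2 (x.z, x.t)

/-- The mirror image `(z, -t)` in the Euclidean space `ℂ × ℝ`. -/
noncomputable def mirror (x : H3) : WithLp 2 (ℂ × ℝ) := WithLp.toLp 2 (x.z, -x.t)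

/-- The hyperbolic distance of the metric `(|dz|² + dt²) / t²`, that is
`sinh (dist x y / 2) = |x - y| / (2 √(x.t y.t))` with the Euclidean norm on the right
(the same normalization as for `UpperHalfPlane`). -/
noncomputable instance : Dist H3 :=
  ⟨fun x y => 2 * Real.arsinh (dist x.toE y.toE / (2 * √(x.t * y.t)))⟩

theorem dist_def (x y : H3) :
    dist x y = 2 * Real.arsinh (dist x.toE y.toE / (2 * √(x.t * y.t))) := rfl

theorem dist_toE_sq (x y : H3) :
    dist x.toE y.toE ^ 2 = ‖x.z - y.z‖ ^ 2 + (x.t - y.t) ^ 2 := by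
  rw [WithLp.prod_dist_eq_of_L2, Real.sq_sqrt (by positivity)]
  simp [toE, dist_eq_norm, sq_abs]

theorem dist_toE_mirror_sq (x y : H3) :
    dist x.toE y.mirror ^ 2 = ‖x.z - y.z‖ ^ 2 + (x.t + y.t) ^ 2 := by
  rw [WithLp.prod_dist_eq_of_L2, Real.sq_sqrt (by positivity)]
  simp [toE, mirror, dist_eq_norm, sq_abs]

theorem dist_toE_mirror_comm (x y : H3) : dist x.toE y.mirror = dist y.toE x.mirror := by
  rw [← sq_eq_sq₀ dist_nonneg dist_nonneg, dist_toE_mirror_sq, dist_toE_mirror_sq,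
    norm_sub_rev, add_comm x.t]

theorem dist_self_mirror (x : H3) : dist x.toE x.mirror = 2 * x.t := by
  have := x.pos
  rw [← sq_eq_sq₀ dist_nonneg (by positivity), dist_toE_mirror_sq]
  simp; ring

theorem sinh_half_dist (x y : H3) :
    Real.sinh (dist x y / 2) = dist x.toE y.toE / (2 * √(x.t * y.t)) := by
  rw [dist_def, mul_div_cancel_left₀ _ two_ne_zero, Real.sinh_arsinh]

theorem cosh_half_dist (x y : H3) :
    Real.cosh (dist x y / 2) = dist x.toE y.mirror / (2 * √(x.t * y.t)) := by
  have hx := x.pos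
  have hy := y.pos
  rw [← sq_eq_sq₀ (Real.cosh_pos _).le (by positivity), Real.cosh_sq', sinh_half_dist, div_pow,
    div_pow, mul_pow, Real.sq_sqrt (by positivity), dist_toE_sq, dist_toE_mirror_sq]
  field_simp
  ring

protected theorem dist_triangle (a b c : H3) : dist a c ≤ dist a b + dist b c := by
  have ha := a.pos
  have hb := b.pos
  have hc := c.pos
  have key : Real.sinh (dist a c / 2) ≤ Real.sinh ((dist a b + dist b c) / 2) := by
    rw [add_div, Real.sinh_add, sinh_half_dist, sinh_half_dist, sinh_half_dist, cosh_half_dist,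
      cosh_half_dist]
    have pt := EuclideanGeometry.mul_dist_le_mul_dist_add_mul_dist a.toE b.toE c.toE b.mirror
    rw [dist_self_mirror] at pt
    rw [dist_toE_mirror_comm b c, Real.sqrt_mul ha.le, Real.sqrt_mul ha.le, Real.sqrt_mul hb.le]
    have sb : √b.t * √b.t = b.t := Real.mul_self_sqrt hb.le
    have e : dist a.toE b.toE / (2 * (√a.t * √b.t)) * (dist c.toE b.mirror / (2 * (√b.t * √c.t)))
        + dist a.toE b.mirror / (2 * (√a.t * √b.t)) * (dist b.toE c.toE / (2 * (√b.t * √c.t)))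
        = (dist a.toE b.toE * dist c.toE b.mirror + dist b.toE c.toE * dist a.toE b.mirror)
          / (2 * (√a.t * √c.t) * (2 * b.t)) := by
      have h1 : 0 < √a.t := Real.sqrt_pos.2 ha
      have h2 : 0 < √b.t := Real.sqrt_pos.2 hb
      have h3 : 0 < √c.t := Real.sqrt_pos.2 hc
      generalize √b.t = u at *
      rw [← sb]
      field_simp
    have hP : 0 < 2 * (√a.t * √c.t) := by positivity
    rw [e, div_le_div_iff₀ hP (by positivity)]
    have := mul_le_mul_of_nonneg_right pt hP.le
    linarith
  have := Real.sinh_le_sinh.1 key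
  linarith

noncomputable instance : MetricSpace H3 where
  dist_self x := by rw [dist_def, dist_self, zero_div, Real.arsinh_zero, mul_zero]
  dist_comm x y := by rw [dist_def, dist_def, dist_comm, mul_comm x.t]
  dist_triangle := H3.dist_triangle
  eq_of_dist_eq_zero {x y} h := by
    have hx := x.pos
    have hy := y.pos
    have h0 : dist x.toE y.toE = 0 := by
      have h1 := sinh_half_dist x y
      rw [h, zero_div, Real.sinh_zero, eq_comm, div_eq_zero_iff] at h1
      exact h1.resolve_right (by positivity)
    have h2 := dist_toE_sq x y
    rw [h0] at h2
    have h3 : ‖x.z - y.z‖ ^ 2 = 0 := by nlinarith [sq_nonneg ‖x.z - y.z‖, sq_nonneg (x.t - y.t)]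
    have h4 : (x.t - y.t) ^ 2 = 0 := by nlinarith [sq_nonneg ‖x.z - y.z‖, sq_nonneg (x.t - y.t)]
    ext1
    · exact sub_eq_zero.1 (norm_eq_zero.1 (pow_eq_zero_iff two_ne_zero |>.1 h3))
    · exact sub_eq_zero.1 (pow_eq_zero_iff two_ne_zero |>.1 h4)

end H3

/-- The topology of the isometry group of `H3`: pointwise convergence (on isometries it agrees
with the compact-open topology). -/
noncomputable instance : TopologicalSpace (H3 ≃ᵢ H3) :=
  TopologicalSpace.induced (fun g : H3 ≃ᵢ H3 => (g : H3 → H3)) inferInstance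

/-- A (discrete) group of isometries is elementary if it has an abelian subgroup of finite index
(for discrete groups: if its limit set has at most two points). -/
def IsElementary (G : Subgroup (H3 ≃ᵢ H3)) : Prop :=
  ∃ K : Subgroup (H3 ≃ᵢ H3), K ≤ G ∧ (∀ x ∈ K, ∀ y ∈ K, x * y = y * x) ∧ K.relIndex G ≠ 0

/-- The orientation preserving isometries of `H3` are the Poincaré extensions of the Moebius
transformations `z ↦ (a z + b) / (c z + d)`, `a d - b c = 1`. -/
def IsOrientationPreserving (g : H3 ≃ᵢ H3) : Prop :=
  ∃ M : SL(2, ℂ), ∀ x : H3,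
    (g x).z = ((M 0 0 * x.z + M 0 1) * conj (M 1 0 * x.z + M 1 1)
        + M 0 0 * conj (M 1 0) * (x.t : ℂ) ^ 2)
          / ((‖M 1 0 * x.z + M 1 1‖ ^ 2 + ‖M 1 0‖ ^ 2 * x.t ^ 2 : ℝ) : ℂ) ∧
    (g x).t = x.t / (‖M 1 0 * x.z + M 1 1‖ ^ 2 + ‖M 1 0‖ ^ 2 * x.t ^ 2)

/-- The translation length of an isometry. For a covering transformation `g` of a hyperbolic
manifold this is the length of the closed geodesic in the free homotopy class determined
by `g`, and it is `0` if `g` is parabolic. -/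
noncomputable def translationLength (g : H3 ≃ᵢ H3) : ℝ := ⨅ x : H3, dist x (g x)

/-- An isometry is parabolic if it has no fixed point and moves some points arbitrarily
little. -/
def IsParabolic (g : H3 ≃ᵢ H3) : Prop :=
  (∀ x, g x ≠ x) ∧ ∀ δ > 0, ∃ x, dist x (g x) < δ

/-! ### Hyperbolic surfaces -/

/-- The isometries of the hyperbolic plane act on it. -/
noncomputable instance : MulAction (ℍ ≃ᵢ ℍ) ℍ where
  smul g z := g z
  one_smul _ := rfl
  mul_smul _ _ _ := rfl

/-- A connected oriented complete hyperbolic surface of finite area, as the quotient of the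
hyperbolic plane by its group `Γ` of covering transformations. -/
structure HyperbolicSurface where
  Γ : Subgroup (ℍ ≃ᵢ ℍ)
  orientation : ∀ g ∈ Γ, ∃ M : SL(2, ℝ), ∀ z : ℍ, g z = M • z
  free : ∀ g ∈ Γ, ∀ z : ℍ, g z = z → g = 1
  properlyDiscontinuous : ∀ (z : ℍ) (r : ℝ), {g | g ∈ Γ ∧ dist z (g z) ≤ r}.Finite
  finiteArea : ∃ F : Set ℍ, MeasurableSet F ∧ MeasureTheory.volume F < ⊤ ∧
    ∀ z : ℍ, ∃ g ∈ Γ, g z ∈ F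

namespace HyperbolicSurface

/-- The surface `ℍ / Γ` itself, with the quotient topology. -/
abbrev Carrier (S : HyperbolicSurface) : Type := MulAction.orbitRel.Quotient S.Γ ℍ

/-- The covering projection. -/
noncomputable def proj (S : HyperbolicSurface) (z : ℍ) : S.Carrier := Quotient.mk _ z

end HyperbolicSurface

/-- A loop is simple if it passes through no point twice, except that it ends where it
starts. -/
def IsSimpleLoop {X : Type} [TopologicalSpace X] {p : X} (a : Path p p) : Prop :=
  ∀ s t : I, a s = a t → s = t ∨ (s = 0 ∧ t = 1) ∨ (s = 1 ∧ t = 0)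

/-- Free homotopy of loops: they become homotopic (with fixed base point) when the base point is
moved along some path. -/
def FreelyHomotopic {X : Type} [TopologicalSpace X] {p q : X} (a : Path p p) (b : Path q q) :
    Prop :=
  ∃ d : Path p q, ((d.symm.trans a).trans d).Homotopic b

/-- A loop is peripheral if it is freely homotopic into the complement of any compact set. On the
interior of a compact surface, these are the loops that are homotopic into the boundary (and, if
the boundary is non-empty, the null-homotopic ones). -/
def IsPeripheral {X : Type} [TopologicalSpace X] {p : X} (a : Path p p) : Prop :=
  ∀ K : Set X, IsCompact K → ∃ (q : X) (b : Path q q), FreelyHomotopic a b ∧ Set.range b ⊆ Kᶜ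

namespace HyperbolicSurface

variable (S : HyperbolicSurface)

/-- A closed geodesic of the surface: the image of a unit speed geodesic `c` of the hyperbolic
plane whose projection has period `l`, run through once over the interval `[0, l]`. -/
def IsClosedGeodesic {p : S.Carrier} (a : Path p p) : Prop :=
  ∃ (c : ℝ → ℍ) (l : ℝ), Isometry c ∧ 0 < l ∧ (∀ t, S.proj (c (t + l)) = S.proj (c t)) ∧
    ∀ t : I, a t = S.proj (c (l * t))

/-- `n` is the geometric intersection number `i(a, b)` of two loops: the number of intersection
points of the simple closed geodesics freely homotopic to them, and `0` if these geodesics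
coincide. -/
def IsGeometricIntersectionNumber {p q : S.Carrier} (a : Path p p) (b : Path q q) (n : ℕ∞) :
    Prop :=
  ∃ (p' q' : S.Carrier) (a' : Path p' p') (b' : Path q' q'),
    (IsSimpleLoop a' ∧ S.IsClosedGeodesic a' ∧ FreelyHomotopic a a') ∧
    (IsSimpleLoop b' ∧ S.IsClosedGeodesic b' ∧ FreelyHomotopic b b') ∧
    ((Set.range a' = Set.range b' ∧ n = 0) ∨
      (Set.range a' ≠ Set.range b' ∧ n = (Set.range a' ∩ Set.range b').encard))

end HyperbolicSurface

/-! ### Hyperbolic 3-manifolds marked by a surface -/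

/-- An element `N` of `AH(S̄ × I, ∂S̄ × I)`, where `S` is the interior of the compact surface `S̄`:
a complete oriented hyperbolic 3-manifold `N = H3 / ρ(π₁(S))` with a homotopy equivalence from
`S̄ × I` that takes `∂S̄ × I` into the cusps. It is given by its holonomy: a discrete faithful
representation `ρ` of `π₁(S)` in the group of orientation preserving isometries of `H3` that
takes the non-trivial peripheral elements to parabolics. -/
structure MarkedHyperbolicManifold (S : HyperbolicSurface) (p : S.Carrier) where
  ρ : FundamentalGroup S.Carrier p →* (H3 ≃ᵢ H3)
  orientation : ∀ γ, IsOrientationPreserving (ρ γ)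
  faithful : Function.Injective ρ
  discrete : DiscreteTopology ρ.range
  cusps : ∀ a : Path p p, ¬ a.Homotopic (Path.refl p) → IsPeripheral a →
    IsParabolic (ρ (FundamentalGroup.fromPath (Path.Homotopic.Quotient.mk a)))

/-- The length in `N` of a loop on `S`: the length of the closed geodesic of `N` in its free
homotopy class, and `0` if there is none because the class is parabolic. -/
noncomputable def MarkedHyperbolicManifold.length {S : HyperbolicSurface} {p : S.Carrier}
    (N : MarkedHyperbolicManifold S p) (a : Path p p) : ℝ :=
  translationLength (N.ρ (FundamentalGroup.fromPath (Path.Homotopic.Quotient.mk a)))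

/-!
An isometry of hyperbolic 3-space is the Poincaré extension of a matrix in `SL(2, ℂ)`, up to a
reflection (`Moebius.isMoebius`), and the whole argument is about traces of such matrices.

Isometries close to the identity, and hence also their conjugates, have a squared trace close to `4`
(`Moebius.nearUnipotent_mem_nhds`, `Moebius.conj_mem_nearUnipotent`). Suppose that this holds for
`M`, `N`, `M N` and `M N⁻¹`. The identity `tr (M N) + tr (M N⁻¹) = tr M * tr N` says that two
numbers of norm about `2` have a sum of norm about `4`, so that, for suitable signs, all four traces
are about `2`. Fricke's identity for the trace of a commutator then makes `tr (M N M⁻¹ N⁻¹)` close to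
`2`, and Jørgensen's inequality (`SL2.jorgensen`) shows that a discrete group generated by `M` and
`N` is abelian by finite (`SL2.jorgensen_of_traces`). This is the first half.

In the second half only the translation lengths of the four isometries are small. The eigenvalues
are then close to the unit circle and the traces have norm at most about `2`. If `tr M ^ 2` and
`tr N ^ 2` are close to `4` the argument above applies. Otherwise, say `tr M ^ 2` is not close to
`4`. By compactness of the circle some bounded power `M ^ k` has eigenvalues whose squares are very
close to `1`. In terms of a basis of eigenvectors of `M`, the bound for the trace of the commutator
bounds the product of the off-diagonal entries of `N`, and Jørgensen's inequality applies to `M ^ k`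
and `N`. Either way some positive powers of the two isometries commute
(`Moebius.exists_pos_commute_pow`).

The representation is faithful, so the same powers of the classes of `α` and `β` commute in the
fundamental group of the surface. The covering transformations along the two closed geodesics, which
are hyperbolic, then have commuting powers, hence the same axis, and the two closed geodesics have
the same image (`HyperbolicSurface.range_eq_of_commute_pow`). So the geometric intersection number
is `0` and not `1`.
-/

/-! ### Poincaré extensions as isometries of hyperbolic space -/

namespace H3

theorem cosh_dist (x y : H3) :
    Real.cosh (dist x y) = 1 + (‖x.z - y.z‖ ^ 2 + (x.t - y.t) ^ 2) / (2 * x.t * y.t) := by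
  have hx := x.pos
  have hy := y.pos
  have h := Real.cosh_two_mul (dist x y / 2)
  rw [mul_div_cancel₀ _ (two_ne_zero' ℝ), Real.cosh_sq', sinh_half_dist, div_pow, mul_pow,
    Real.sq_sqrt (by positivity), dist_toE_sq] at h
  rw [h]
  field_simp
  ring

/-- The point `(z, t)` as a positive Hermitian matrix of determinant `1`. In this model of
hyperbolic space a matrix `M` acts by `X ↦ M X Mᴴ`. -/
noncomputable def herm (x : H3) : Matrix (Fin 2) (Fin 2) ℂ :=
  !![(x.z * conj x.z + (x.t : ℂ) ^ 2) / x.t, x.z / x.t; conj x.z / x.t, 1 / x.t]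

/-- The base point `(0, 1)` of hyperbolic space. -/
noncomputable def base : H3 := ⟨0, 1, one_pos⟩

theorem t_ne_zero (x : H3) : (x.t : ℂ) ≠ 0 := Complex.ofReal_ne_zero.2 x.pos.ne'

theorem herm_injective : Function.Injective herm := by
  intro x y h
  have h1 : (1 : ℂ) / x.t = 1 / y.t := congrFun (congrFun h 1) 1
  have h2 : x.z / x.t = y.z / y.t := congrFun (congrFun h 0) 1
  have ht : (x.t : ℂ) = y.t := by simpa using h1
  rw [ht, div_left_inj' y.t_ne_zero] at h2
  exact H3.ext h2 (Complex.ofReal_injective ht)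

theorem trace_herm_mul_adjugate (x y : H3) :
    (x.herm * y.herm.adjugate).trace = (2 * Real.cosh (dist x y) : ℝ) := by
  have hx := x.t_ne_zero
  have hy := y.t_ne_zero
  rw [cosh_dist]
  push_cast
  rw [← Complex.mul_conj', map_sub]
  simp [herm, Matrix.adjugate_fin_two, Matrix.trace_fin_two]
  field_simp
  ring

theorem dist_eq_of_trace {x y x' y' : H3}
    (h : (x.herm * y.herm.adjugate).trace = (x'.herm * y'.herm.adjugate).trace) :
    dist x y = dist x' y' := by
  rw [trace_herm_mul_adjugate, trace_herm_mul_adjugate] at h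
  have h1 := Complex.ofReal_injective h
  have h2 : Real.cosh (dist x y) = Real.cosh (dist x' y') := by linarith
  exact Real.cosh_strictMonoOn.injOn (Set.mem_Ici.2 dist_nonneg) (Set.mem_Ici.2 dist_nonneg) h2

end H3

theorem det_eq_one' {R : Type*} [CommRing R] (M : SL(2, R)) :
    M 0 0 * M 1 1 - M 0 1 * M 1 0 = 1 := by
  have := M.det_coe
  rwa [Matrix.det_fin_two] at this

namespace Moebius

theorem denom_pos (M : SL(2, ℂ)) (x : H3) :
    0 < ‖M 1 0 * x.z + M 1 1‖ ^ 2 + ‖M 1 0‖ ^ 2 * x.t ^ 2 := by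
  have hx := x.pos
  by_cases hc : M 1 0 = 0
  · have hd : M 1 1 ≠ 0 := by
      intro hd
      simpa [hc, hd] using det_eq_one' M
    have : 0 < ‖M 1 1‖ := norm_pos_iff.2 hd
    simp only [hc, zero_mul, zero_add, norm_zero]
    positivity
  · have : 0 < ‖M 1 0‖ := norm_pos_iff.2 hc
    positivity

/-- The Poincaré extension of a Moebius transformation, as a map of hyperbolic space. -/
noncomputable def act (M : SL(2, ℂ)) (x : H3) : H3 where
  z := ((M 0 0 * x.z + M 0 1) * conj (M 1 0 * x.z + M 1 1)
        + M 0 0 * conj (M 1 0) * (x.t : ℂ) ^ 2)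
          / ((‖M 1 0 * x.z + M 1 1‖ ^ 2 + ‖M 1 0‖ ^ 2 * x.t ^ 2 : ℝ) : ℂ)
  t := x.t / (‖M 1 0 * x.z + M 1 1‖ ^ 2 + ‖M 1 0‖ ^ 2 * x.t ^ 2)
  pos := div_pos x.pos (denom_pos M x)

theorem herm_act (M : SL(2, ℂ)) (x : H3) :
    (act M x).herm = (M : Matrix (Fin 2) (Fin 2) ℂ) * x.herm *
      (M : Matrix (Fin 2) (Fin 2) ℂ).conjTranspose := by
  have hx := x.t_ne_zero
  have hD : ((‖M 1 0 * x.z + M 1 1‖ ^ 2 + ‖M 1 0‖ ^ 2 * x.t ^ 2 : ℝ) : ℂ) ≠ 0 :=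
    Complex.ofReal_ne_zero.2 (denom_pos M x).ne'
  have hD' : ((‖M 1 0 * x.z + M 1 1‖ ^ 2 + ‖M 1 0‖ ^ 2 * x.t ^ 2 : ℝ) : ℂ) =
      (M 1 0 * x.z + M 1 1) * (conj (M 1 0) * conj x.z + conj (M 1 1))
        + M 1 0 * conj (M 1 0) * (x.t : ℂ) ^ 2 := by
    push_cast
    rw [← Complex.mul_conj', ← Complex.mul_conj', map_add, map_mul]
  have h := det_eq_one' M
  have h' : conj (M 0 0) * conj (M 1 1) - conj (M 0 1) * conj (M 1 0) = 1 := by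
    rw [← map_mul, ← map_mul, ← map_sub, h, map_one]
  have key : (act M x).herm = !![
      (M 0 0 * (x.z * conj x.z + (x.t : ℂ) ^ 2) * conj (M 0 0) + M 0 0 * x.z * conj (M 0 1)
        + M 0 1 * conj x.z * conj (M 0 0) + M 0 1 * conj (M 0 1)) / x.t,
      (M 0 0 * (x.z * conj x.z + (x.t : ℂ) ^ 2) * conj (M 1 0) + M 0 0 * x.z * conj (M 1 1)
        + M 0 1 * conj x.z * conj (M 1 0) + M 0 1 * conj (M 1 1)) / x.t;
      (M 1 0 * (x.z * conj x.z + (x.t : ℂ) ^ 2) * conj (M 0 0) + M 1 0 * x.z * conj (M 0 1)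
        + M 1 1 * conj x.z * conj (M 0 0) + M 1 1 * conj (M 0 1)) / x.t,
      (M 1 0 * (x.z * conj x.z + (x.t : ℂ) ^ 2) * conj (M 1 0) + M 1 0 * x.z * conj (M 1 1)
        + M 1 1 * conj x.z * conj (M 1 0) + M 1 1 * conj (M 1 1)) / x.t] := by
    simp only [H3.herm, act, Complex.ofReal_div]
    generalize ((‖M 1 0 * x.z + M 1 1‖ ^ 2 + ‖M 1 0‖ ^ 2 * x.t ^ 2 : ℝ) : ℂ) = D at hD hD'
    have hDc : conj D = D := by
      rw [hD']
      simp only [map_add, map_mul, Complex.conj_conj, Complex.conj_ofReal, map_pow]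
      ring
    simp only [map_div₀, map_add, map_mul, Complex.conj_conj, Complex.conj_ofReal, map_pow, hDc]
    ext i j
    fin_cases i <;> fin_cases j <;> simp
    · field_simp
      linear_combination (-(M 0 0 * (x.z * conj x.z + (x.t : ℂ) ^ 2) * conj (M 0 0)
        + M 0 0 * x.z * conj (M 0 1) + M 0 1 * conj x.z * conj (M 0 0)
        + M 0 1 * conj (M 0 1))) * hD'
        - (x.t : ℂ) ^ 2 * (conj (M 0 0) * conj (M 1 1) - conj (M 0 1) * conj (M 1 0)) * h
        - (x.t : ℂ) ^ 2 * h'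
    · field_simp
      ring
    · field_simp
      ring
    · field_simp
      linear_combination hD'
  rw [key]
  ext i j
  fin_cases i <;> fin_cases j <;>
    simp [H3.herm, Matrix.mul_apply, Fin.sum_univ_two] <;> field_simp <;> ring

theorem act_mul (M N : SL(2, ℂ)) (x : H3) : act (M * N) x = act M (act N x) := by
  apply H3.herm_injective
  rw [herm_act, herm_act, herm_act, Matrix.SpecialLinearGroup.coe_mul, Matrix.conjTranspose_mul]
  simp only [Matrix.mul_assoc]

theorem act_one (x : H3) : act 1 x = x := by
  apply H3.herm_injective
  rw [herm_act, Matrix.SpecialLinearGroup.coe_one, Matrix.conjTranspose_one, one_mul, mul_one]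

theorem dist_act (M : SL(2, ℂ)) (x y : H3) : dist (act M x) (act M y) = dist x y := by
  apply H3.dist_eq_of_trace
  rw [herm_act, herm_act, Matrix.adjugate_mul_distrib, Matrix.adjugate_mul_distrib]
  have h1 : (M : Matrix (Fin 2) (Fin 2) ℂ).conjTranspose
      * (M : Matrix (Fin 2) (Fin 2) ℂ).conjTranspose.adjugate = 1 := by
    rw [Matrix.mul_adjugate, Matrix.det_conjTranspose, M.det_coe, star_one, one_smul]
  have h2 : (M : Matrix (Fin 2) (Fin 2) ℂ).adjugate * (M : Matrix (Fin 2) (Fin 2) ℂ) = 1 := by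
    rw [Matrix.adjugate_mul, M.det_coe, one_smul]
  generalize (M : Matrix (Fin 2) (Fin 2) ℂ).conjTranspose = C at *
  generalize (M : Matrix (Fin 2) (Fin 2) ℂ) = A at *
  calc (A * x.herm * C * (C.adjugate * (y.herm.adjugate * A.adjugate))).trace
      = (A * (x.herm * (C * C.adjugate) * y.herm.adjugate * A.adjugate)).trace := by
        simp only [Matrix.mul_assoc]
    _ = (x.herm * (C * C.adjugate) * y.herm.adjugate * (A.adjugate * A)).trace := by
        rw [Matrix.trace_mul_comm]
        simp only [Matrix.mul_assoc]
    _ = _ := by rw [h1, h2, mul_one, mul_one]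

/-- The Poincaré extension, as a homomorphism to the isometry group of hyperbolic space. -/
noncomputable def toIsom : SL(2, ℂ) →* (H3 ≃ᵢ H3) where
  toFun M :=
    { toFun := act M
      invFun := act M⁻¹
      left_inv := fun x => by rw [← act_mul, inv_mul_cancel, act_one]
      right_inv := fun x => by rw [← act_mul, mul_inv_cancel, act_one]
      isometry_toFun := Isometry.of_dist_eq (dist_act M) }
  map_one' := by ext x : 1; exact act_one x
  map_mul' M N := by ext x : 1; exact act_mul M N x

theorem toIsom_apply (M : SL(2, ℂ)) (x : H3) : toIsom M x = act M x := rfl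

theorem exists_toIsom_eq {g : H3 ≃ᵢ H3} (hg : IsOrientationPreserving g) :
    ∃ M : SL(2, ℂ), g = toIsom M := by
  obtain ⟨M, hM⟩ := hg
  refine ⟨M, ?_⟩
  ext x : 1
  exact H3.ext (hM x).1 (hM x).2

theorem herm_base : H3.base.herm = 1 := by
  simp [H3.herm, H3.base, Matrix.one_fin_two]

/-- A matrix that commutes with `diag (2, 1/2)` and with `!![2, 1; 1, 1]` is scalar. -/
theorem entries_of_commute {M : Matrix (Fin 2) (Fin 2) ℂ}
    (h1 : M * !![2, 0; 0, 1 / 2] = !![2, 0; 0, 1 / 2] * M)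
    (h2 : M * !![2, 1; 1, 1] = !![2, 1; 1, 1] * M) :
    M 0 1 = 0 ∧ M 1 0 = 0 ∧ M 0 0 = M 1 1 := by
  have e1 := congrFun (congrFun h1 0) 1
  have e2 := congrFun (congrFun h1 1) 0
  have e3 := congrFun (congrFun h2 0) 1
  simp [Matrix.mul_apply, Fin.sum_univ_two] at e1 e2 e3
  have e4 : M 0 1 = 0 := by linear_combination (-2 / 3 : ℂ) * e1
  refine ⟨e4, by linear_combination (2 / 3 : ℂ) * e2, by linear_combination e3 + e4⟩

theorem herm_two (h : (0 : ℝ) < 2) : (H3.mk 0 2 h).herm = !![2, 0; 0, 1 / 2] := by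
  simp [H3.herm, pow_two]

theorem herm_one (h : (0 : ℝ) < 1) : (H3.mk 1 1 h).herm = !![2, 1; 1, 1] := by
  simp [H3.herm]; norm_num

theorem toIsom_eq_one_iff (M : SL(2, ℂ)) : toIsom M = 1 ↔ M = 1 ∨ M = -1 := by
  constructor
  · intro h
    have hf (x : H3) : (M : Matrix (Fin 2) (Fin 2) ℂ) * x.herm
        * (M : Matrix (Fin 2) (Fin 2) ℂ).conjTranspose = x.herm := by
      rw [← herm_act, ← toIsom_apply, h]
      rfl
    have hu := hf H3.base
    rw [herm_base, mul_one] at hu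
    have hx (x : H3) : (M : Matrix (Fin 2) (Fin 2) ℂ) * x.herm
        = x.herm * (M : Matrix (Fin 2) (Fin 2) ℂ) := by
      conv_rhs => rw [← hf x]
      rw [Matrix.mul_assoc, mul_eq_one_comm.1 hu, mul_one]
    have e1 := hx ⟨0, 2, two_pos⟩
    have e2 := hx ⟨1, 1, one_pos⟩
    rw [herm_two] at e1
    rw [herm_one] at e2
    obtain ⟨hb, hc, had⟩ := entries_of_commute e1 e2
    have hdet := det_eq_one' M
    have : (M 1 1 - 1) * (M 1 1 + 1) = 0 := by
      rw [hb, had] at hdet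
      linear_combination hdet
    rcases mul_eq_zero.1 this with h | h
    · left
      have hd := sub_eq_zero.1 h
      ext i j
      fin_cases i <;> fin_cases j <;> simp [hb, hc, had, hd]
    · right
      have hd := eq_neg_of_add_eq_zero_left h
      ext i j
      fin_cases i <;> fin_cases j <;> simp [hb, hc, had, hd]
  · rintro (rfl | rfl)
    · exact map_one _
    · ext x : 1
      apply H3.herm_injective
      rw [toIsom_apply, herm_act]
      simp

theorem toIsom_eq_iff (M N : SL(2, ℂ)) : toIsom M = toIsom N ↔ M = N ∨ M = -N := by
  rw [← mul_inv_eq_one, ← map_inv, ← map_mul, toIsom_eq_one_iff, mul_inv_eq_one,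
    mul_inv_eq_iff_eq_mul, neg_one_mul]

theorem norm_sq_sum (M : SL(2, ℂ)) :
    ‖M 0 0‖ ^ 2 + ‖M 0 1‖ ^ 2 + ‖M 1 0‖ ^ 2 + ‖M 1 1‖ ^ 2
      = 2 * Real.cosh (dist (act M H3.base) H3.base) := by
  have h := H3.trace_herm_mul_adjugate (act M H3.base) H3.base
  rw [herm_act, herm_base, mul_one, Matrix.adjugate_one, mul_one] at h
  apply Complex.ofReal_injective
  rw [← h]
  push_cast
  simp only [← Complex.mul_conj', Matrix.trace_fin_two, Matrix.mul_apply, Fin.sum_univ_two,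
    Matrix.conjTranspose_apply, ← starRingEnd_apply]
  ring

end Moebius

namespace H3

/-- The reflection `(z, t) ↦ (conj z, t)`. -/
noncomputable def conjMap (x : H3) : H3 := ⟨conj x.z, x.t, x.pos⟩

theorem herm_conjMap (x : H3) : x.conjMap.herm = x.herm.transpose := by
  ext i j
  fin_cases i <;> fin_cases j <;> simp [herm, conjMap, mul_comm]

theorem conjMap_conjMap (x : H3) : x.conjMap.conjMap = x := by
  ext <;> simp [conjMap]

theorem dist_conjMap (x y : H3) : dist x.conjMap y.conjMap = dist x y := by
  apply dist_eq_of_trace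
  rw [herm_conjMap, herm_conjMap, ← Matrix.adjugate_transpose, ← Matrix.transpose_mul,
    Matrix.trace_transpose, Matrix.trace_mul_comm]

/-- The reflection `(z, t) ↦ (conj z, t)`, as an isometry. -/
noncomputable def reflection : H3 ≃ᵢ H3 where
  toFun := conjMap
  invFun := conjMap
  left_inv := conjMap_conjMap
  right_inv := conjMap_conjMap
  isometry_toFun := Isometry.of_dist_eq dist_conjMap

theorem reflection_mul_self : reflection * reflection = 1 := by
  ext x : 1
  exact conjMap_conjMap x

end H3

namespace Moebius

open H3

/-- The complex conjugate of a matrix. -/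
noncomputable def conjMat (M : SL(2, ℂ)) : SL(2, ℂ) :=
  Matrix.SpecialLinearGroup.map (starRingEnd ℂ) M

theorem conjMat_apply (M : SL(2, ℂ)) (i j : Fin 2) : conjMat M i j = conj (M i j) := rfl

theorem reflection_mul_toIsom (M : SL(2, ℂ)) :
    reflection * toIsom M = toIsom (conjMat M) * reflection := by
  ext x : 1
  apply herm_injective
  change (act M x).conjMap.herm = (act (conjMat M) x.conjMap).herm
  rw [herm_act, herm_conjMap, herm_conjMap, herm_act]
  ext i j
  fin_cases i <;> fin_cases j <;>
    simp [Matrix.mul_apply, Fin.sum_univ_two, conjMat_apply] <;> ring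

theorem toIsom_mul_reflection_ne_one (M : SL(2, ℂ)) : toIsom M * reflection ≠ 1 := by
  intro h
  have hf (x : H3) : (M : Matrix (Fin 2) (Fin 2) ℂ) * x.herm.transpose
      * (M : Matrix (Fin 2) (Fin 2) ℂ).conjTranspose = x.herm := by
    rw [← herm_conjMap, ← herm_act]
    exact congrArg herm (congrArg (fun g : H3 ≃ᵢ H3 => g x) h)
  have hu := hf H3.base
  rw [herm_base, Matrix.transpose_one, mul_one] at hu
  have hx (x : H3) : (M : Matrix (Fin 2) (Fin 2) ℂ) * x.herm.transpose
      = x.herm * (M : Matrix (Fin 2) (Fin 2) ℂ) := by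
    conv_rhs => rw [← hf x]
    rw [Matrix.mul_assoc, mul_eq_one_comm.1 hu, mul_one]
  have e1 := hx ⟨0, 2, two_pos⟩
  have e2 := hx ⟨1, 1, one_pos⟩
  have e3 := hx ⟨Complex.I, 1, one_pos⟩
  have t1 : (!![2, 0; 0, 1 / 2] : Matrix (Fin 2) (Fin 2) ℂ).transpose = !![2, 0; 0, 1 / 2] := by
    ext i j; fin_cases i <;> fin_cases j <;> simp
  have t2 : (!![2, 1; 1, 1] : Matrix (Fin 2) (Fin 2) ℂ).transpose = !![2, 1; 1, 1] := by
    ext i j; fin_cases i <;> fin_cases j <;> simp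
  rw [herm_two, t1] at e1
  rw [herm_one, t2] at e2
  obtain ⟨hb, hc, had⟩ := entries_of_commute e1 e2
  have hdet := det_eq_one' M
  have e4 := congrFun (congrFun e3 0) 1
  simp [herm, Matrix.mul_apply, Fin.sum_univ_two, hb, had] at e4
  have hI := Complex.I_ne_zero
  have h0 : M 1 1 = 0 := by
    have : M 1 1 * Complex.I = 0 := by linear_combination (-1 / 2 : ℂ) * e4
    simpa using this
  rw [hb, h0] at hdet
  simp at hdet

end Moebius

/-! ### All isometries of hyperbolic space -/

namespace H3

/-- The distances to `(0, 1)` and `(0, 2)` determine the height and the norm of the horizontal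
component. -/
theorem eq_of_dist_axis {x y : H3} {h2 : (0 : ℝ) < 2} (h1 : dist x base = dist y base)
    (h : dist x ⟨0, 2, h2⟩ = dist y ⟨0, 2, h2⟩) : x.t = y.t ∧ ‖x.z‖ ^ 2 = ‖y.z‖ ^ 2 := by
  have e1 := congrArg Real.cosh h1
  have e2 := congrArg Real.cosh h
  have hx := x.pos
  have hy := y.pos
  simp only [cosh_dist, base, sub_zero] at e1 e2
  field_simp at e1 e2
  have : x.t = y.t := by nlinarith
  refine ⟨this, ?_⟩
  rw [this] at e1
  have := mul_right_cancel₀ hy.ne' (by linarith : ‖x.z‖ ^ 2 * y.t = ‖y.z‖ ^ 2 * y.t)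
  exact this

theorem re_eq_of_dist {x y : H3} (u : ℂ) (ht : x.t = y.t) (hz : ‖x.z‖ ^ 2 = ‖y.z‖ ^ 2)
    (h : dist x ⟨u, 1, one_pos⟩ = dist y ⟨u, 1, one_pos⟩) :
    (x.z * conj u).re = (y.z * conj u).re := by
  have e := congrArg Real.cosh h
  have hy := y.pos
  simp only [cosh_dist, ht] at e
  field_simp at e
  simp only [← Complex.normSq_eq_norm_sq, Complex.normSq_sub] at e hz
  linarith

end H3

namespace Moebius

open H3

/-- The isometries that are Poincaré extensions, or the product of one with the reflection. -/
def IsMoebius (g : H3 ≃ᵢ H3) : Prop :=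
  ∃ M : SL(2, ℂ), g = toIsom M ∨ g = toIsom M * reflection

theorem IsMoebius.of_toIsom_mul {g : H3 ≃ᵢ H3} (N : SL(2, ℂ)) (h : IsMoebius (toIsom N * g)) :
    IsMoebius g := by
  obtain ⟨M, hM | hM⟩ := h
  · refine ⟨N⁻¹ * M, Or.inl ?_⟩
    rw [map_mul, ← hM, map_inv, inv_mul_cancel_left]
  · refine ⟨N⁻¹ * M, Or.inr ?_⟩
    rw [map_mul, mul_assoc, ← hM, map_inv, inv_mul_cancel_left]

theorem IsMoebius.of_reflection_mul {g : H3 ≃ᵢ H3} (h : IsMoebius (reflection * g)) :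
    IsMoebius g := by
  have hg : g = reflection * (reflection * g) := by
    rw [← mul_assoc, reflection_mul_self, one_mul]
  obtain ⟨M, hM | hM⟩ := h
  · refine ⟨conjMat M, Or.inr ?_⟩
    rw [hg, hM, reflection_mul_toIsom]
  · refine ⟨conjMat M, Or.inl ?_⟩
    rw [hg, hM, ← mul_assoc, reflection_mul_toIsom, mul_assoc, reflection_mul_self, mul_one]

theorem act_diagonal {a d : ℂ} (h : Matrix.det !![a, 0; 0, d] = 1) (x : H3) :
    act ⟨!![a, 0; 0, d], h⟩ x = ⟨a * conj d * x.z / ((‖d‖ ^ 2 : ℝ) : ℂ), x.t / ‖d‖ ^ 2,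
      div_pos x.pos (pow_pos (norm_pos_iff.2 (by rintro rfl; simp at h)) 2)⟩ := by
  ext
  · simp [act]; ring
  · simp [act]

theorem exists_act_eq_base (x : H3) : ∃ M : SL(2, ℂ), act M x = base := by
  have hx := x.pos
  have hs : (√x.t : ℂ) ^ 2 = x.t := by
    rw [← Complex.ofReal_pow, Real.sq_sqrt hx.le]
  have hs0 : (√x.t : ℂ) ≠ 0 := Complex.ofReal_ne_zero.2 (Real.sqrt_pos.2 hx).ne'
  refine ⟨⟨!![1 / √x.t, -x.z / √x.t; 0, √x.t], ?_⟩, ?_⟩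
  · rw [Matrix.det_fin_two_of]
    field_simp
    simp
  · ext
    · simp [act, base]
      left; field_simp; ring
    · simp [act, base, Real.sq_sqrt hx.le, hx.ne']

/-- The stabilizer of `(0, 1)` acts transitively on the sphere of radius `d((0, 1), (0, 2))`. -/
theorem exists_act_eq_two {y : H3} {h2 : (0 : ℝ) < 2}
    (h : dist y base = dist (⟨0, 2, h2⟩ : H3) base) :
    ∃ M : SL(2, ℂ), act M base = base ∧ act M y = ⟨0, 2, h2⟩ := by
  have hy := y.pos
  have hy0 := y.t_ne_zero
  have e := congrArg Real.cosh h
  simp only [cosh_dist, base, sub_zero, norm_zero] at e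
  field_simp at e
  have ht : 0 ≤ (2 - y.t) * (2 * y.t - 1) := by nlinarith [sq_nonneg ‖y.z‖]
  have hn : ‖y.z‖ ^ 2 = 5 / 2 * y.t - y.t ^ 2 - 1 := by nlinarith
  rcases eq_or_ne (2 * y.t - 1) 0 with h0 | h0
  · have ht' : y.t = 1 / 2 := by linarith
    have hz : y.z = 0 := by
      rw [ht'] at hn
      norm_num at hn
      exact hn
    refine ⟨⟨!![0, -1; 1, 0], by simp⟩, ?_, ?_⟩
    · ext <;> simp [act, base]
    · ext
      · simp [act, hz]
      · simp [act, hz, ht']; norm_num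
  · have hp : 0 < 2 * y.t - 1 := by
      refine lt_of_le_of_ne ?_ h0.symm
      by_contra hneg
      nlinarith
    -- `M` is unitary and its first row is dual to an eigenvector of `y.herm` for the eigenvalue `2`
    obtain ⟨p, hpdef⟩ : ∃ p : ℝ, p = 2 * y.t - 1 := ⟨_, rfl⟩
    obtain ⟨k, hk, hkk⟩ : ∃ k : ℝ, 0 < k ∧ k ^ 2 = 3 / 2 * y.t * p :=
      ⟨√(3 / 2 * y.t * p), by rw [hpdef]; positivity, Real.sq_sqrt (by rw [hpdef]; positivity)⟩
    have hkn : k ^ 2 = p ^ 2 + ‖y.z‖ ^ 2 := by rw [hkk, hn, hpdef]; ring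
    have hK : (k : ℂ) ≠ 0 := Complex.ofReal_ne_zero.2 hk.ne'
    have hN : y.z * conj y.z = ((‖y.z‖ ^ 2 : ℝ) : ℂ) := by
      rw [Complex.mul_conj']; push_cast; rfl
    have hKN : (k : ℂ) ^ 2 = p ^ 2 + y.z * conj y.z := by
      rw [hN]; exact_mod_cast hkn
    refine ⟨⟨!![p / k, y.z / k; -conj y.z / k, p / k], ?_⟩, ?_, ?_⟩
    · rw [Matrix.det_fin_two_of]
      field_simp
      linear_combination -hKN
    · ext
      · simp [act, base]
        left; field_simp; ring
      · simp [act, base]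
        field_simp
        rw [sq_abs, sq_abs]
        linarith
    · have hw : -conj y.z / k * y.z + p / k = (((p - ‖y.z‖ ^ 2) / k : ℝ) : ℂ) := by
        push_cast
        field_simp
        rw [← Complex.mul_conj']
        ring
      have hpn : p - ‖y.z‖ ^ 2 = y.t * p / 2 := by rw [hn, hpdef]; ring
      ext
      · simp only [act, Matrix.of_apply, Matrix.cons_val', Matrix.cons_val_zero,
          Matrix.cons_val_one, Matrix.cons_val_fin_one, hw, hpn]
        rw [div_eq_zero_iff]
        left
        simp only [Complex.conj_ofReal, map_div₀, map_neg, Complex.conj_conj]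
        push_cast
        rw [hpdef]
        push_cast
        field_simp
        ring
      · simp only [act, Matrix.of_apply, Matrix.cons_val', Matrix.cons_val_zero,
          Matrix.cons_val_one, Matrix.cons_val_fin_one, hw, hpn]
        simp only [Complex.norm_real, norm_div, norm_neg, Complex.norm_conj,
          Real.norm_eq_abs, sq_abs, div_pow]
        have : (y.t * p / 2) ^ 2 / k ^ 2 + ‖y.z‖ ^ 2 / k ^ 2 * y.t ^ 2 = y.t / 2 := by
          rw [hn, hkk]
          have : p ≠ 0 := by rw [hpdef]; exact h0
          field_simp
          rw [hpdef]
          ring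
        rw [div_pow] at this
        rw [this]
        field_simp

/-- An isometry fixing the four points `(0, 1)`, `(0, 2)`, `(1, 1)`, `(i, 1)` is trivial. -/
theorem eq_one_of_fixed {g : H3 ≃ᵢ H3} (h0 : g base = base)
    (h1 : g ⟨0, 2, two_pos⟩ = ⟨0, 2, two_pos⟩)
    (h2 : g ⟨1, 1, one_pos⟩ = ⟨1, 1, one_pos⟩)
    (h3 : g ⟨Complex.I, 1, one_pos⟩ = ⟨Complex.I, 1, one_pos⟩) : g = 1 := by
  ext x : 1
  have key {p : H3} (hp : g p = p) : dist (g x) p = dist x p := by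
    conv_lhs => rw [← hp]
    exact g.dist_eq x p
  obtain ⟨ht, hz⟩ := eq_of_dist_axis (key h0) (key h1)
  have hr := re_eq_of_dist 1 ht hz (key h2)
  have hi := re_eq_of_dist Complex.I ht hz (key h3)
  simp at hr hi
  exact H3.ext (Complex.ext hr hi) ht

/-- Every isometry of hyperbolic space is a Poincaré extension, up to a reflection. -/
theorem isMoebius (g : H3 ≃ᵢ H3) : IsMoebius g := by
  wlog h0 : g base = base generalizing g
  · obtain ⟨M, hM⟩ := exists_act_eq_base (g base)
    exact .of_toIsom_mul M (this _ hM)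
  wlog h1 : g ⟨0, 2, two_pos⟩ = ⟨0, 2, two_pos⟩ generalizing g
  · have hd : dist (g ⟨0, 2, two_pos⟩) base = dist (⟨0, 2, two_pos⟩ : H3) base := by
      conv_lhs => rw [← h0]
      exact g.dist_eq _ _
    obtain ⟨M, hM, hM'⟩ := exists_act_eq_two hd
    refine .of_toIsom_mul M (this _ ?_ hM')
    change act M (g base) = base
    rw [h0, hM]
  have key (x : H3) : (g x).t = x.t ∧ ‖(g x).z‖ ^ 2 = ‖x.z‖ ^ 2 := by
    apply eq_of_dist_axis (h2 := two_pos)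
    · conv_lhs => rw [← h0]
      exact g.dist_eq _ _
    · conv_lhs => rw [← h1]
      exact g.dist_eq _ _
  wlog h2 : g ⟨1, 1, one_pos⟩ = ⟨1, 1, one_pos⟩ generalizing g
  · obtain ⟨ht, hz⟩ := key ⟨1, 1, one_pos⟩
    simp only [norm_one, one_pow] at hz ht
    have hz1 : ‖(g ⟨1, 1, one_pos⟩).z‖ = 1 := by
      rwa [pow_eq_one_iff_of_nonneg (norm_nonneg _) two_ne_zero] at hz
    obtain ⟨a, ha⟩ := IsAlgClosed.exists_pow_nat_eq (conj (g ⟨1, 1, one_pos⟩).z) two_pos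
    have ha1 : ‖a‖ = 1 := by
      have : ‖a‖ ^ 2 = 1 := by rw [← norm_pow, ha, Complex.norm_conj, hz1]
      rwa [pow_eq_one_iff_of_nonneg (norm_nonneg _) two_ne_zero] at this
    have hac : a * conj a = 1 := by rw [Complex.mul_conj', ha1]; simp
    have hdet : Matrix.det !![a, 0; 0, conj a] = 1 := by simp [hac]
    have hfix (x : H3) (hx : a ^ 2 * x.z = x.z) : act ⟨!![a, 0; 0, conj a], hdet⟩ x = x := by
      rw [act_diagonal]
      ext
      · simp [ha1, ← pow_two, hx]
      · simp [ha1]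
    refine .of_toIsom_mul ⟨!![a, 0; 0, conj a], hdet⟩ (this _ ?_ ?_ ?_ ?_)
    · change act _ (g base) = base
      rw [h0, hfix]
      simp [base]
    · change act _ (g _) = _
      rw [h1, hfix]
      simp
    · intro x
      change (act _ (g x)).t = _ ∧ ‖(act _ (g x)).z‖ ^ 2 = _
      rw [act_diagonal]
      simpa [ha1] using key x
    · change act _ (g _) = _
      rw [act_diagonal]
      ext
      · simp [ha1, ← pow_two, ha, Complex.conj_mul', hz1]
      · simp [ha1, ht]
  have hI : g ⟨Complex.I, 1, one_pos⟩ = ⟨Complex.I, 1, one_pos⟩ ∨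
      g ⟨Complex.I, 1, one_pos⟩ = ⟨-Complex.I, 1, one_pos⟩ := by
    obtain ⟨ht, hz⟩ := key ⟨Complex.I, 1, one_pos⟩
    have hr := re_eq_of_dist 1 ht hz (by conv_lhs => {rw [← h2]}; exact g.dist_eq _ _)
    simp at hr
    simp only [← Complex.normSq_eq_norm_sq, Complex.normSq_apply, hr] at hz
    simp at hz
    rcases mul_self_eq_one_iff.1 hz with h | h
    · exact Or.inl (H3.ext (Complex.ext (by simp [hr]) (by simp [h])) ht)
    · exact Or.inr (H3.ext (Complex.ext (by simp [hr]) (by simp [h])) ht)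
  rcases hI with hI | hI
  · refine ⟨1, Or.inl ?_⟩
    rw [map_one, eq_one_of_fixed h0 h1 h2 hI]
  · refine .of_reflection_mul ⟨1, Or.inl ?_⟩
    rw [map_one]
    apply eq_one_of_fixed <;> change conjMap (g _) = _
    · rw [h0]; simp [conjMap, base]
    · rw [h1]; simp [conjMap]
    · rw [h2]; simp [conjMap]
    · rw [hI]; simp [conjMap]

end Moebius

/-! ### The topology of the isometry group -/

namespace H3

theorem tendsto_of_coords {ι : Type*} {l : Filter ι} {f : ι → H3} {x : H3}
    (hz : Filter.Tendsto (fun i => (f i).z) l (𝓝 x.z))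
    (ht : Filter.Tendsto (fun i => (f i).t) l (𝓝 x.t)) : Filter.Tendsto f l (𝓝 x) := by
  rw [tendsto_iff_dist_tendsto_zero]
  have h1 : Filter.Tendsto (fun i => dist (f i).toE x.toE) l (𝓝 0) := by
    rw [← tendsto_iff_dist_tendsto_zero]
    exact ((WithLp.prod_continuous_toLp 2 ℂ ℝ).tendsto (x.z, x.t)).comp (hz.prodMk_nhds ht)
  have h2 : Filter.Tendsto (fun i => 2 * √((f i).t * x.t)) l (𝓝 (2 * √(x.t * x.t))) :=
    ((ht.mul_const _).sqrt).const_mul 2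
  have h3 : 2 * √(x.t * x.t) ≠ 0 := by
    have := x.pos
    positivity
  have h4 := ((Real.continuous_arsinh.tendsto _).comp (h1.div h2 h3)).const_mul 2
  simpa [dist_def] using h4

end H3

namespace Moebius

open H3 Filter

theorem continuous_coe_apply (i j : Fin 2) : Continuous fun M : SL(2, ℂ) => M i j :=
  (continuous_apply_apply i j).comp continuous_subtype_val

theorem continuous_toIsom : Continuous toIsom := by
  rw [continuous_induced_rng]
  refine continuous_pi fun x => continuous_iff_continuousAt.2 fun M => ?_
  have c00 := (continuous_coe_apply 0 0).continuousAt (x := M)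
  have c01 := (continuous_coe_apply 0 1).continuousAt (x := M)
  have c10 := (continuous_coe_apply 1 0).continuousAt (x := M)
  have c11 := (continuous_coe_apply 1 1).continuousAt (x := M)
  have hD : ContinuousAt
      (fun M : SL(2, ℂ) => ‖M 1 0 * x.z + M 1 1‖ ^ 2 + ‖M 1 0‖ ^ 2 * x.t ^ 2) M :=
    (((c10.mul continuousAt_const).add c11).norm.pow 2).add
      ((c10.norm.pow 2).mul continuousAt_const)
  refine tendsto_of_coords ?_ ?_
  · refine ContinuousAt.div
      (f := fun M : SL(2, ℂ) => (M 0 0 * x.z + M 0 1) * conj (M 1 0 * x.z + M 1 1)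
        + M 0 0 * conj (M 1 0) * (x.t : ℂ) ^ 2)
      (g := fun M : SL(2, ℂ) => ((‖M 1 0 * x.z + M 1 1‖ ^ 2 + ‖M 1 0‖ ^ 2 * x.t ^ 2 : ℝ) : ℂ)) ?_
      (Complex.continuous_ofReal.continuousAt.comp hD)
      (Complex.ofReal_ne_zero.2 (denom_pos M x).ne')
    have h1 : ContinuousAt (fun M : SL(2, ℂ) => conj (M 1 0 * x.z + M 1 1)) M :=
      Complex.continuous_conj.continuousAt.comp ((c10.mul continuousAt_const).add c11)
    have h2 : ContinuousAt (fun M : SL(2, ℂ) => conj (M 1 0)) M :=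
      Complex.continuous_conj.continuousAt.comp c10
    exact (((c00.mul continuousAt_const).add c01).mul h1).add ((c00.mul h2).mul continuousAt_const)
  · exact ContinuousAt.div continuousAt_const hD (denom_pos M x).ne'

theorem continuous_trace : Continuous fun M : SL(2, ℂ) => M 0 0 + M 1 1 :=
  (continuous_coe_apply 0 0).add (continuous_coe_apply 1 1)

theorem isCompact_setOf_norm_le (C : ℝ) : IsCompact {M : SL(2, ℂ) | ∀ i j, ‖M i j‖ ≤ C} := by
  have h : IsCompact
      {M : Matrix (Fin 2) (Fin 2) ℂ | ∀ i j, M i j ∈ Metric.closedBall (0 : ℂ) C} := by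
    have := isCompact_univ_pi (X := fun _ : Fin 2 => Fin 2 → ℂ)
      (s := fun _ => Set.pi Set.univ fun _ => Metric.closedBall (0 : ℂ) C)
      fun _ => isCompact_univ_pi fun _ => isCompact_closedBall _ _
    convert! this using 1
    ext M
    exact ⟨fun h i _ j _ => h i j, fun h i j => h i trivial j trivial⟩
  have hc : IsClosed (Set.range ((↑) : SL(2, ℂ) → Matrix (Fin 2) (Fin 2) ℂ)) := by
    have : Set.range ((↑) : SL(2, ℂ) → Matrix (Fin 2) (Fin 2) ℂ) = {M | M.det = 1} := by
      ext M
      exact ⟨by rintro ⟨N, rfl⟩; exact N.2, fun h => ⟨⟨M, h⟩, rfl⟩⟩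
    rw [this]
    exact isClosed_singleton.preimage (continuous_id.matrix_det)
  have he : Topology.IsClosedEmbedding ((↑) : SL(2, ℂ) → Matrix (Fin 2) (Fin 2) ℂ) :=
    ⟨.subtypeVal, hc⟩
  have h2 := he.isCompact_preimage h
  have h3 : {M : SL(2, ℂ) | ∀ i j, ‖M i j‖ ≤ C} = ((↑) : SL(2, ℂ) → Matrix (Fin 2) (Fin 2) ℂ) ⁻¹'
      {M | ∀ i j, M i j ∈ Metric.closedBall (0 : ℂ) C} := by
    ext M
    simp only [← mem_closedBall_zero_iff]
    exact Iff.rfl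
  rw [h3]
  exact h2

theorem tendsto_apply {l : Filter (H3 ≃ᵢ H3)} {g : H3 ≃ᵢ H3} (h : l ≤ 𝓝 g) (x : H3) :
    Tendsto (fun f : H3 ≃ᵢ H3 => f x) l (𝓝 (g x)) :=
  (((continuous_apply x).comp continuous_induced_dom).tendsto g).mono_left h

/-- The set of Poincaré extensions whose squared trace is close to `4`. -/
def nearUnipotent (δ : ℝ) : Set (H3 ≃ᵢ H3) :=
  {g | ∃ M : SL(2, ℂ), g = toIsom M ∧ ‖(M 0 0 + M 1 1) ^ 2 - 4‖ < δ}

/-- Isometries close to the identity preserve the orientation and have squared trace close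
to `4`. -/
theorem nearUnipotent_mem_nhds {δ : ℝ} (hδ : 0 < δ) : nearUnipotent δ ∈ 𝓝 (1 : H3 ≃ᵢ H3) := by
  rw [mem_iff_ultrafilter]
  intro F hF
  choose M hM using isMoebius
  have hK : ∀ᶠ g in (F : Filter (H3 ≃ᵢ H3)),
      M g ∈ {M : SL(2, ℂ) | ∀ i j, ‖M i j‖ ≤ √(2 * Real.cosh 1)} := by
    have h1 : ∀ᶠ g in (F : Filter (H3 ≃ᵢ H3)), dist (g base) base < 1 :=
      (tendsto_apply hF base).eventually (Metric.ball_mem_nhds _ one_pos)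
    filter_upwards [h1] with g hg
    have hb : g base = act (M g) base := by
      rcases hM g with h | h <;> conv_lhs => rw [h]
      · rfl
      · change act (M g) (conjMap base) = _
        congr 1
        simp [conjMap, base]
    have hs := norm_sq_sum (M g)
    rw [← hb] at hs
    have hc : Real.cosh (dist (g base) base) ≤ Real.cosh 1 := by
      rw [Real.cosh_le_cosh, abs_of_nonneg dist_nonneg, abs_one]
      exact hg.le
    intro i j
    apply Real.le_sqrt_of_sq_le
    fin_cases i <;> fin_cases j <;> simp <;>
      nlinarith [sq_nonneg ‖M g 0 0‖, sq_nonneg ‖M g 0 1‖, sq_nonneg ‖M g 1 0‖, sq_nonneg ‖M g 1 1‖]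
  obtain ⟨N, -, hN⟩ :=
    (isCompact_setOf_norm_le _).ultrafilter_le_nhds (F.map M) (le_principal_iff.2 hK)
  have hN' : Tendsto M F (𝓝 N) := hN
  have hlim (x : H3) : Tendsto (fun g => toIsom (M g) x) F (𝓝 (toIsom N x)) :=
    (((continuous_apply x).comp (continuous_induced_dom.comp continuous_toIsom)).tendsto N).comp hN'
  have hor : ∀ᶠ g in (F : Filter (H3 ≃ᵢ H3)), g = toIsom (M g) ∨ g = toIsom (M g) * reflection :=
    Eventually.of_forall hM
  rcases Ultrafilter.eventually_or.1 hor with h | h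
  · have hN1 : toIsom N = 1 := by
      ext x : 1
      refine tendsto_nhds_unique (hlim x) ((tendsto_apply hF x).congr' ?_)
      filter_upwards [h] with g hg
      conv_lhs => rw [hg]
    have ht : (N 0 0 + N 1 1) ^ 2 - 4 = 0 := by
      rcases (toIsom_eq_one_iff N).1 hN1 with rfl | rfl <;> simp <;> norm_num
    have h2 : Tendsto (fun g => ‖(M g 0 0 + M g 1 1) ^ 2 - 4‖) F (𝓝 0) := by
      have :=
        (((continuous_trace.pow 2).sub (continuous_const (y := (4 : ℂ)))).norm.tendsto N).comp hN'
      simpa [ht, Function.comp_def] using this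
    filter_upwards [h, h2.eventually (gt_mem_nhds hδ)] with g hg hg'
    exact ⟨M g, hg, hg'⟩
  · exfalso
    apply toIsom_mul_reflection_ne_one N
    ext x : 1
    refine tendsto_nhds_unique (hlim (reflection x)) ((tendsto_apply hF x).congr' ?_)
    filter_upwards [h] with g hg
    conv_lhs => rw [hg]
    rfl

theorem conj_mem_nearUnipotent {δ : ℝ} {g : H3 ≃ᵢ H3} (hg : g ∈ nearUnipotent δ) (h : H3 ≃ᵢ H3) :
    h * g * h⁻¹ ∈ nearUnipotent δ := by
  have key (N : SL(2, ℂ)) {g : H3 ≃ᵢ H3} (hg : g ∈ nearUnipotent δ) :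
      toIsom N * g * (toIsom N)⁻¹ ∈ nearUnipotent δ := by
    obtain ⟨M, rfl, hM⟩ := hg
    refine ⟨N * M * N⁻¹, by simp only [map_mul, map_inv], ?_⟩
    have : ((N * M * N⁻¹ : SL(2, ℂ)) 0 0 + (N * M * N⁻¹ : SL(2, ℂ)) 1 1) = M 0 0 + M 1 1 := by
      rw [← Matrix.trace_fin_two, ← Matrix.trace_fin_two, Matrix.SpecialLinearGroup.coe_mul,
        Matrix.trace_mul_comm, ← Matrix.SpecialLinearGroup.coe_mul, inv_mul_cancel_left]
    rwa [this]
  obtain ⟨N, rfl | rfl⟩ := isMoebius h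
  · exact key N hg
  · rw [mul_inv_rev, mul_assoc _ reflection, mul_assoc, ← mul_assoc _ _ (toIsom N)⁻¹, ← mul_assoc]
    apply key
    obtain ⟨M, rfl, hM⟩ := hg
    refine ⟨conjMat M, ?_, ?_⟩
    · rw [reflection_mul_toIsom, mul_assoc, mul_inv_cancel, mul_one]
    · have : (conjMat M 0 0 + conjMat M 1 1) ^ 2 - 4 = conj ((M 0 0 + M 1 1) ^ 2 - 4) := by
        simp [conjMat_apply, Complex.conj_ofNat]
      rwa [this, Complex.norm_conj]

end Moebius

/-! ### Abelian-by-finite pairs and trace identities -/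

/-- Some abelian subgroup contains `a`, is normalized by `b` and contains a positive power of `b`.
The group generated by `a` and `b` then has an abelian normal subgroup with finite cyclic
quotient. -/
def AbelianByFinite {G : Type*} [Group G] (a b : G) : Prop :=
  ∃ T : Subgroup G, (∀ x ∈ T, ∀ y ∈ T, x * y = y * x) ∧ a ∈ T ∧
    (∀ x ∈ T, b * x * b⁻¹ ∈ T ∧ b⁻¹ * x * b ∈ T) ∧ ∃ m : ℕ, 0 < m ∧ b ^ m ∈ T

theorem AbelianByFinite.map {G G' : Type*} [Group G] [Group G'] {a b : G}
    (h : AbelianByFinite a b) (f : G →* G') : AbelianByFinite (f a) (f b) := by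
  obtain ⟨T, hT, ha, hb, m, hm, hbm⟩ := h
  refine ⟨T.map f, ?_, Subgroup.mem_map_of_mem f ha, ?_, m, hm, ?_⟩
  · rintro _ ⟨x, hx, rfl⟩ _ ⟨y, hy, rfl⟩
    rw [← map_mul, hT x hx y hy, map_mul]
  · rintro _ ⟨x, hx, rfl⟩
    simp only [← map_mul, ← map_inv]
    exact ⟨Subgroup.mem_map_of_mem f (hb x hx).1, Subgroup.mem_map_of_mem f (hb x hx).2⟩
  · rw [← map_pow]
    exact Subgroup.mem_map_of_mem f hbm

theorem AbelianByFinite.commute_pow {G : Type*} [Group G] {a b : G} (h : AbelianByFinite a b) :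
    ∃ m : ℕ, 0 < m ∧ Commute a (b ^ m) := by
  obtain ⟨T, hT, ha, hb, m, hm, hbm⟩ := h
  exact ⟨m, hm, hT _ ha _ hbm⟩

theorem AbelianByFinite.isElementary {A B : H3 ≃ᵢ H3} (h : AbelianByFinite A B) :
    IsElementary (Subgroup.closure {A, B}) := by
  obtain ⟨T, hT, hA, hB, m, hm, hBm⟩ := h
  have hN : ∀ (k : ℤ), ∀ x ∈ T, B ^ k * x * (B ^ k)⁻¹ ∈ T := by
    have hBn : B ∈ Subgroup.normalizer (T : Set (H3 ≃ᵢ H3)) := by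
      rw [Subgroup.mem_normalizer_iff]
      refine fun x => ⟨fun hx => (hB x hx).1, fun hx => ?_⟩
      have := (hB _ hx).2
      simpa [mul_assoc] using this
    intro k x hx
    have := Subgroup.zpow_mem _ hBn k
    rw [Subgroup.mem_normalizer_iff] at this
    exact (this x).1 hx
  have hmem : ∀ g ∈ Subgroup.closure {A, B}, ∃ k : ℤ, ∃ x ∈ T, g = x * B ^ k := by
    intro g hg
    induction hg using Subgroup.closure_induction with
    | mem g hg =>
      rcases hg with rfl | rfl
      · exact ⟨0, _, hA, by simp⟩
      · exact ⟨1, 1, T.one_mem, by simp⟩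
    | one => exact ⟨0, 1, T.one_mem, by simp⟩
    | mul g g' _ _ h h' =>
      obtain ⟨k, x, hx, rfl⟩ := h
      obtain ⟨l, y, hy, rfl⟩ := h'
      refine ⟨k + l, x * (B ^ k * y * (B ^ k)⁻¹), T.mul_mem hx (hN k y hy), ?_⟩
      rw [zpow_add]
      group
    | inv g _ h =>
      obtain ⟨k, x, hx, rfl⟩ := h
      refine ⟨-k, B ^ (-k) * x⁻¹ * (B ^ (-k))⁻¹, hN _ _ (T.inv_mem hx), ?_⟩
      group
  set G := Subgroup.closure {A, B} with hG
  have hBG : B ∈ G := Subgroup.subset_closure (by simp)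
  refine ⟨T ⊓ G, inf_le_right, fun x hx y hy => hT x hx.1 y hy.1, ?_⟩
  rw [Subgroup.inf_relIndex_right, Subgroup.relIndex]
  rw [← Subgroup.finiteIndex_iff, Subgroup.finiteIndex_iff_finite_quotient]
  refine Finite.of_surjective (fun i : Fin m =>
    (QuotientGroup.mk (⟨B, hBG⟩ ^ (i : ℕ))⁻¹ : G ⧸ T.subgroupOf G)) ?_
  intro q
  obtain ⟨⟨g, hg⟩, rfl⟩ := QuotientGroup.mk_surjective q
  obtain ⟨k, x, hx, hgk⟩ := hmem g⁻¹ (G.inv_mem hg)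
  have hm' : (m : ℤ) ≠ 0 := by exact_mod_cast hm.ne'
  have hlt := Int.emod_lt_of_pos k (by exact_mod_cast hm : (0 : ℤ) < m)
  have hnn := Int.emod_nonneg k hm'
  refine ⟨⟨(k % m).toNat, by omega⟩, ?_⟩
  rw [QuotientGroup.eq, Subgroup.mem_subgroupOf]
  have hk : ((k % m).toNat : ℤ) = k % m := Int.toNat_of_nonneg (Int.emod_nonneg k hm')
  have hg' : g = (B ^ k)⁻¹ * x⁻¹ := by rw [← inv_inj, hgk]; simp
  have e : B ^ (k % m) = (B ^ m) ^ (-(k / m)) * B ^ k := by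
    rw [← zpow_natCast B m, ← zpow_mul, ← zpow_add]
    congr 1
    have := Int.emod_add_mul_ediv k m
    linarith
  have : ((((⟨B, hBG⟩ : G) ^ ((k % m).toNat))⁻¹)⁻¹ * ⟨g, hg⟩ : G) = (B ^ m) ^ (-(k / m)) * x⁻¹ := by
    rw [inv_inv]
    push_cast
    rw [← zpow_natCast B, hk, e, hg']
    group
  rw [this]
  exact T.mul_mem (T.zpow_mem hBm _) (T.inv_mem hx)

namespace SL2

variable {R : Type*} [CommRing R]

theorem mul_apply (M N : SL(2, R)) (i j : Fin 2) :
    (M * N) i j = M i 0 * N 0 j + M i 1 * N 1 j := by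
  rw [Matrix.SpecialLinearGroup.coe_mul, Matrix.mul_apply, Fin.sum_univ_two]

theorem inv_apply (M : SL(2, R)) : M⁻¹ 0 0 = M 1 1 ∧ M⁻¹ 0 1 = -M 0 1 ∧ M⁻¹ 1 0 = -M 1 0 ∧
    M⁻¹ 1 1 = M 0 0 := by
  rw [Matrix.SpecialLinearGroup.SL2_inv_expl]
  exact ⟨rfl, rfl, rfl, rfl⟩

theorem ext_iff' {M N : SL(2, R)} : M = N ↔
    M 0 0 = N 0 0 ∧ M 0 1 = N 0 1 ∧ M 1 0 = N 1 0 ∧ M 1 1 = N 1 1 := by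
  constructor
  · rintro rfl; exact ⟨rfl, rfl, rfl, rfl⟩
  · rintro ⟨h1, h2, h3, h4⟩
    ext i j
    fin_cases i <;> fin_cases j <;> assumption

/-- The trace of a matrix of determinant one. -/
def tr (M : SL(2, R)) : R := M 0 0 + M 1 1

theorem tr_mul_comm (M N : SL(2, R)) : tr (M * N) = tr (N * M) := by
  simp only [tr, mul_apply]; ring

theorem tr_conj (X M : SL(2, R)) : tr (X * M * X⁻¹) = tr M := by
  rw [tr_mul_comm, inv_mul_cancel_left]

theorem tr_neg (M : SL(2, R)) : tr (-M) = -tr M := by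
  simp [tr]; ring

theorem tr_mul_inv (M N : SL(2, R)) : tr (M * N⁻¹) = tr M * tr N - tr (M * N) := by
  obtain ⟨h1, h2, h3, h4⟩ := inv_apply N
  simp only [tr, mul_apply, h1, h2, h3, h4]; ring

/-- Fricke's identity for the trace of a commutator. -/
theorem tr_commutator (M N : SL(2, R)) : tr (M * N * M⁻¹ * N⁻¹) =
    tr M ^ 2 + tr N ^ 2 + tr (M * N) ^ 2 - tr M * tr N * tr (M * N) - 2 := by
  have e1 : tr (M * N * M⁻¹ * N) = tr (M * N) * tr (N⁻¹ * M) - tr (M * N * (N⁻¹ * M)) := by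
    rw [← tr_mul_inv, mul_inv_rev, inv_inv, mul_assoc (M * N)]
  have e2 : tr (N⁻¹ * M) = tr M * tr N - tr (M * N) := by rw [tr_mul_comm, tr_mul_inv]
  have e3 := tr_mul_inv M M
  rw [mul_inv_cancel] at e3
  have e4 : tr (1 : SL(2, R)) = 2 := by simp [tr]; norm_num
  have e5 : M * N * (N⁻¹ * M) = M * M := by group
  rw [tr_mul_inv, e1, e2, e5, tr_conj]
  linear_combination e3 - e4

theorem conj_apply (N M : SL(2, R)) :
    (N * M * N⁻¹) 0 0 = N 0 0 * N 1 1 * M 0 0 - N 0 1 * N 1 0 * M 1 1 - N 0 0 * N 1 0 * M 0 1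
      + N 0 1 * N 1 1 * M 1 0 ∧
    (N * M * N⁻¹) 0 1 = N 0 0 * N 0 1 * (M 1 1 - M 0 0) + N 0 0 ^ 2 * M 0 1 - N 0 1 ^ 2 * M 1 0 ∧
    (N * M * N⁻¹) 1 0 = N 1 0 * N 1 1 * (M 0 0 - M 1 1) - N 1 0 ^ 2 * M 0 1 + N 1 1 ^ 2 * M 1 0 ∧
    (N * M * N⁻¹) 1 1 = N 0 0 * N 1 1 * M 1 1 - N 0 1 * N 1 0 * M 0 0 + N 0 0 * N 1 0 * M 0 1
      - N 0 1 * N 1 1 * M 1 0 := by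
  obtain ⟨h1, h2, h3, h4⟩ := inv_apply N
  simp only [mul_apply, h1, h2, h3, h4]
  refine ⟨?_, ?_, ?_, ?_⟩ <;> ring

end SL2

/-! ### Jørgensen's inequality for diagonal and parabolic matrices -/

namespace SL2

open Filter

/-- A group of matrices that is discrete up to sign: its only elements close to the identity
are `±1`. -/
def IsDiscreteUpToSign (H : Subgroup SL(2, ℂ)) : Prop :=
  ∀ᶠ M in 𝓝 (1 : SL(2, ℂ)), M ∈ H → M = 1 ∨ M = -1

theorem IsDiscreteUpToSign.conj {H : Subgroup SL(2, ℂ)} (hH : IsDiscreteUpToSign H)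
    (X : SL(2, ℂ)) : IsDiscreteUpToSign (H.map (MulAut.conj X).toMonoidHom) := by
  have hc : Tendsto (fun M : SL(2, ℂ) => X⁻¹ * M * X) (𝓝 1) (𝓝 1) := by
    have : Continuous fun M : SL(2, ℂ) => X⁻¹ * M * X := by fun_prop
    simpa using this.tendsto 1
  filter_upwards [hc.eventually hH] with M hM hMH
  obtain ⟨Y, hY, rfl⟩ := hMH
  have e : X⁻¹ * (X * Y * X⁻¹) * X = Y := by group
  simp only [MulEquiv.coe_toMonoidHom, MulAut.conj_apply, e] at hM ⊢
  rcases hM hY with rfl | rfl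
  · left; simp
  · right; simp

theorem tendsto_iff {ι : Type*} {l : Filter ι} {f : ι → SL(2, ℂ)} {M : SL(2, ℂ)} :
    Tendsto f l (𝓝 M) ↔ ∀ i j, Tendsto (fun n => f n i j) l (𝓝 (M i j)) := by
  refine tendsto_subtype_rng.trans (tendsto_pi_nhds.trans ?_)
  simp only [tendsto_pi_nhds]

/-- A sequence of conjugations `N ↦ N M N⁻¹`, as in the proof of Jørgensen's inequality. -/
def iterConj (M N : SL(2, ℂ)) : ℕ → SL(2, ℂ)
  | 0 => N
  | n + 1 => iterConj M N n * M * (iterConj M N n)⁻¹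

theorem iterConj_mem {H : Subgroup SL(2, ℂ)} {M N : SL(2, ℂ)} (hM : M ∈ H) (hN : N ∈ H) (n : ℕ) :
    iterConj M N n ∈ H := by
  induction n with
  | zero => exact hN
  | succ n ih => exact H.mul_mem (H.mul_mem ih hM) (H.inv_mem ih)

theorem IsDiscreteUpToSign.exists_eq {H : Subgroup SL(2, ℂ)} (hH : IsDiscreteUpToSign H)
    {M : SL(2, ℂ)} (hM : M ∈ H) {f : ℕ → SL(2, ℂ)} (hf : ∀ n, f n ∈ H)
    (h : Tendsto f atTop (𝓝 M)) : ∃ n, f n = M ∨ f n = -M := by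
  have h1 : Tendsto (fun n => f n * M⁻¹) atTop (𝓝 1) := by
    simpa using h.mul_const M⁻¹
  obtain ⟨n, hn⟩ := (h1.eventually hH).exists
  refine ⟨n, ?_⟩
  simpa [mul_inv_eq_iff_eq_mul] using hn (H.mul_mem (hf n) (H.inv_mem hM))

/-- The diagonal matrices. -/
def diagonalSubgroup : Subgroup SL(2, ℂ) where
  carrier := {M | M 0 1 = 0 ∧ M 1 0 = 0}
  mul_mem' := by
    rintro M N ⟨h1, h2⟩ ⟨h3, h4⟩
    simp [mul_apply, h1, h2, h3, h4]
  one_mem' := by simp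
  inv_mem' := by
    rintro M ⟨h1, h2⟩
    obtain ⟨_, k2, k3, _⟩ := inv_apply M
    simp [k2, k3, h1, h2]

theorem mem_diagonalSubgroup {M : SL(2, ℂ)} : M ∈ diagonalSubgroup ↔ M 0 1 = 0 ∧ M 1 0 = 0 :=
  Iff.rfl

/-- The products of `±1` and a matrix `!![1, x; 0, 1]`. -/
def unipotentSubgroup : Subgroup SL(2, ℂ) where
  carrier := {M | M 1 0 = 0 ∧ M 0 0 ^ 2 = 1}
  mul_mem' := by
    rintro M N ⟨h1, h2⟩ ⟨h3, h4⟩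
    refine ⟨by simp [mul_apply, h1, h3], ?_⟩
    simp only [mul_apply, h3, mul_zero, add_zero]
    linear_combination N 0 0 ^ 2 * h2 + h4
  one_mem' := by simp
  inv_mem' := by
    rintro M ⟨h1, h2⟩
    obtain ⟨k1, _, k3, _⟩ := inv_apply M
    have := det_eq_one' M
    refine ⟨by simp [k3, h1], ?_⟩
    rw [h1, mul_zero, sub_zero] at this
    rw [k1]
    linear_combination (-M 1 1 ^ 2) * h2 + (M 0 0 * M 1 1 + 1) * this

theorem mem_unipotentSubgroup {M : SL(2, ℂ)} :
    M ∈ unipotentSubgroup ↔ M 1 0 = 0 ∧ M 0 0 ^ 2 = 1 :=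
  Iff.rfl

theorem eq_of_mem_unipotentSubgroup {M : SL(2, ℂ)} (h : M ∈ unipotentSubgroup) :
    M 1 1 = M 0 0 := by
  obtain ⟨h1, h2⟩ := h
  have h3 := det_eq_one' M
  rw [h1, mul_zero, sub_zero] at h3
  linear_combination (-M 1 1) * h2 + M 0 0 * h3

theorem abelianByFinite_of_diagonal {M N : SL(2, ℂ)} (hM : M ∈ diagonalSubgroup)
    (hN : N ∈ diagonalSubgroup ∨ (N 0 0 = 0 ∧ N 1 1 = 0)) : AbelianByFinite M N := by
  refine ⟨diagonalSubgroup, ?_, hM, ?_, 2, two_pos, ?_⟩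
  · rintro X ⟨h1, h2⟩ Y ⟨h3, h4⟩
    rw [ext_iff']
    simp [mul_apply, h1, h2, h3, h4, mul_comm]
  · have key : ∀ Z : SL(2, ℂ), (Z ∈ diagonalSubgroup ∨ (Z 0 0 = 0 ∧ Z 1 1 = 0)) →
        ∀ X ∈ diagonalSubgroup, Z * X * Z⁻¹ ∈ diagonalSubgroup := by
      rintro Z hZ X ⟨h1, h2⟩
      obtain ⟨_, k2, k3, _⟩ := conj_apply Z X
      rw [mem_diagonalSubgroup, k2, k3, h1, h2]
      rcases hZ with ⟨h3, h4⟩ | ⟨h3, h4⟩ <;> simp [h3, h4]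
    refine fun X hX => ⟨key N hN X hX, ?_⟩
    have := key N⁻¹ ?_ X hX
    · rwa [inv_inv] at this
    · rcases hN with h | h
      · exact Or.inl (Subgroup.inv_mem _ h)
      · obtain ⟨k1, _, _, k4⟩ := inv_apply N
        exact Or.inr ⟨k1.trans h.2, k4.trans h.1⟩
  · rw [pow_two, mem_diagonalSubgroup]
    rcases hN with ⟨h3, h4⟩ | ⟨h3, h4⟩ <;> simp [mul_apply, h3, h4]

/-- Jørgensen's inequality for a diagonal matrix `M ≠ ±1`. -/
theorem jorgensen_diagonal {H : Subgroup SL(2, ℂ)} (hH : IsDiscreteUpToSign H) {M N : SL(2, ℂ)}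
    (hM : M ∈ H) (hN : N ∈ H) (hMd : M ∈ diagonalSubgroup) (hne : M 0 0 ≠ M 1 1)
    (h : ‖M 0 0 - M 1 1‖ ^ 2 * (1 + ‖N 0 1 * N 1 0‖) < 1 / 16) : AbelianByFinite M N := by
  apply abelianByFinite_of_diagonal hMd
  obtain ⟨h01, h10⟩ := hMd
  have hdet := det_eq_one' M
  rw [h01, zero_mul, sub_zero] at hdet
  set κ := M 0 0 - M 1 1 with hκ
  have hκ0 : κ ≠ 0 := sub_ne_zero.2 hne
  set F := iterConj M N with hF
  set w : ℕ → ℂ := fun n => F n 0 1 * F n 1 0 with hw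
  have had (n : ℕ) : F n 0 0 * F n 1 1 = 1 + w n := by
    linear_combination det_eq_one' (F n)
  have hrec (n : ℕ) : F (n + 1) 0 0 = M 0 0 + w n * κ ∧ F (n + 1) 0 1 = -(F n 0 0 * κ) * F n 0 1 ∧
      F (n + 1) 1 0 = (F n 1 1 * κ) * F n 1 0 ∧ F (n + 1) 1 1 = M 1 1 - w n * κ := by
    obtain ⟨k1, k2, k3, k4⟩ := conj_apply (F n) M
    change (F n * M * (F n)⁻¹) 0 0 = _ ∧ (F n * M * (F n)⁻¹) 0 1 = _ ∧ (F n * M * (F n)⁻¹) 1 0 = _ ∧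
      (F n * M * (F n)⁻¹) 1 1 = _
    rw [k1, k2, k3, k4, h01, h10, had]
    refine ⟨?_, ?_, ?_, ?_⟩ <;> simp only [hw, hκ] <;> ring
  have hwrec (n : ℕ) : w (n + 1) = -(w n * (1 + w n) * κ ^ 2) := by
    obtain ⟨-, k2, k3, -⟩ := hrec n
    rw [← had]
    simp only [hw]
    rw [k2, k3]
    ring
  have hwle (n : ℕ) : ‖w n‖ ≤ ‖w 0‖ * (1 / 16) ^ n ∧ ‖w n‖ ≤ ‖w 0‖ := by
    induction n with
    | zero => simp
    | succ n ih =>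
      have hb : ‖w (n + 1)‖ ≤ ‖w n‖ * (1 / 16) := by
        rw [hwrec, norm_neg, norm_mul, norm_mul, norm_pow, mul_assoc]
        refine mul_le_mul_of_nonneg_left ?_ (norm_nonneg _)
        have h1 : ‖1 + w n‖ ≤ 1 + ‖w 0‖ := (norm_add_le _ _).trans (by simpa using ih.2)
        calc ‖1 + w n‖ * ‖κ‖ ^ 2 ≤ (1 + ‖w 0‖) * ‖κ‖ ^ 2 := by gcongr
          _ ≤ 1 / 16 := by rw [mul_comm]; exact h.le
      constructor
      · rw [pow_succ, ← mul_assoc]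
        exact hb.trans (mul_le_mul_of_nonneg_right ih.1 (by norm_num))
      · linarith [norm_nonneg (w n), ih.2]
  have hw0 : Tendsto w atTop (𝓝 0) := by
    refine squeeze_zero_norm (fun n => (hwle n).1) ?_
    simpa using (tendsto_pow_atTop_nhds_zero_of_lt_one (by norm_num : (0 : ℝ) ≤ 1 / 16)
      (by norm_num)).const_mul ‖w 0‖
  have hκ4 : ‖κ‖ < 1 / 4 := by
    have := norm_nonneg κ
    have := norm_nonneg (N 0 1 * N 1 0)
    nlinarith [mul_nonneg (sq_nonneg ‖κ‖) this]
  -- if `x y = 1` and `x - y` is small then `x (x - y)` is small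
  have hsmall {x y : ℂ} (hxy : x * y = 1) (hd : ‖x - y‖ < 1 / 4) : ‖x‖ * ‖x - y‖ < 1 / 2 := by
    have e : x ^ 2 = 1 + x * (x - y) := by linear_combination hxy
    have : ‖x‖ ^ 2 ≤ 1 + ‖x‖ * ‖x - y‖ := by
      rw [← norm_pow, e]
      exact (norm_add_le _ _).trans (by simp)
    have h2 : ‖x‖ ≤ 2 := by
      by_contra! h2
      nlinarith [norm_nonneg (x - y)]
    nlinarith [norm_nonneg (x - y), norm_nonneg x]
  have ha : Tendsto (fun n => F (n + 1) 0 0) atTop (𝓝 (M 0 0)) := by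
    have : (fun n => F (n + 1) 0 0) = fun n => M 0 0 + w n * κ := funext fun n => (hrec n).1
    rw [this]
    simpa using (hw0.mul_const κ).const_add (M 0 0)
  have hd : Tendsto (fun n => F (n + 1) 1 1) atTop (𝓝 (M 1 1)) := by
    have : (fun n => F (n + 1) 1 1) = fun n => M 1 1 - w n * κ := funext fun n => (hrec n).2.2.2
    rw [this]
    simpa using (hw0.mul_const κ).const_sub (M 1 1)
  have hb : Tendsto (fun n => F (n + 1) 0 1) atTop (𝓝 0) := by
    refine (summable_of_ratio_norm_eventually_le (r := 1 / 2) (by norm_num) ?_).tendsto_atTop_zero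
    have := (ha.norm.mul_const ‖κ‖).eventually (gt_mem_nhds (hsmall hdet hκ4))
    filter_upwards [this] with n hn
    rw [(hrec (n + 1)).2.1, norm_mul, norm_neg, norm_mul]
    exact mul_le_mul_of_nonneg_right hn.le (norm_nonneg _)
  have hc : Tendsto (fun n => F (n + 1) 1 0) atTop (𝓝 0) := by
    refine (summable_of_ratio_norm_eventually_le (r := 1 / 2) (by norm_num) ?_).tendsto_atTop_zero
    have h' := hsmall (x := M 1 1) (y := M 0 0) (by rw [mul_comm]; exact hdet)
      (by rw [norm_sub_rev]; exact hκ4)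
    rw [norm_sub_rev] at h'
    have := (hd.norm.mul_const ‖κ‖).eventually (gt_mem_nhds h')
    filter_upwards [this] with n hn
    rw [(hrec (n + 1)).2.2.1, norm_mul, norm_mul]
    exact mul_le_mul_of_nonneg_right hn.le (norm_nonneg _)
  have hlim : Tendsto (fun n => F (n + 1)) atTop (𝓝 M) := by
    rw [tendsto_iff]
    intro i j
    fin_cases i <;> fin_cases j
    · exact ha
    · simpa [h01] using hb
    · simpa [h10] using hc
    · exact hd
  obtain ⟨n, hn⟩ : ∃ n, F (n + 1) = M ∨ F (n + 1) = -M :=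
    hH.exists_eq hM (fun n => iterConj_mem hM hN (n + 1)) hlim
  have hdiag : F (n + 1) ∈ diagonalSubgroup := by
    rw [mem_diagonalSubgroup]
    rcases hn with hn | hn <;> rw [hn] <;> simp [h01, h10]
  have hback (n : ℕ) (hn : F (n + 1) ∈ diagonalSubgroup) :
      F n ∈ diagonalSubgroup ∨ (F n 0 0 = 0 ∧ F n 1 1 = 0) := by
    obtain ⟨hn1, hn2⟩ := hn
    obtain ⟨-, k2, k3, -⟩ := hrec n
    rw [k2] at hn1
    rw [k3] at hn2
    have hF1 := det_eq_one' (F n)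
    have h1 : F n 0 0 = 0 ∨ F n 0 1 = 0 := by simpa [hκ0] using hn1
    have h2 : F n 1 1 = 0 ∨ F n 1 0 = 0 := by simpa [hκ0] using hn2
    rcases h1 with h1 | h1 <;> rcases h2 with h2 | h2
    · exact Or.inr ⟨h1, h2⟩
    · simp [h1, h2] at hF1
    · simp [h1, h2] at hF1
    · exact Or.inl ⟨h1, h2⟩
  have htr : tr M ≠ 0 := by
    intro h0
    have e : κ ^ 2 = -4 := by
      have : κ ^ 2 = tr M ^ 2 - 4 := by rw [hκ, tr]; linear_combination (-4 : ℂ) * hdet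
      rw [this, h0]; norm_num
    have := congrArg norm e
    rw [norm_pow, norm_neg] at this
    norm_num at this
    nlinarith [norm_nonneg κ]
  have hall (m : ℕ) (hm : F (m + 1) ∈ diagonalSubgroup) : F 1 ∈ diagonalSubgroup := by
    induction m with
    | zero => exact hm
    | succ m ih =>
      apply ih
      refine (hback _ hm).resolve_right fun h0 => htr ?_
      rw [← tr_conj (F m) M]
      change tr (F (m + 1)) = 0
      rw [tr, h0.1, h0.2, add_zero]
  exact hback 0 (hall n hdiag)

/-- Powers of a complex number of norm one come back close to `1`. -/
theorem exists_norm_pow_sub_one_lt {u : ℂ} (hu : ‖u‖ = 1) {η : ℝ} (hη : 0 < η) :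
    ∃ k : ℕ, 0 < k ∧ ‖u ^ k - 1‖ < η := by
  obtain ⟨v, -, φ, hφ, hv⟩ := (isCompact_closedBall (0 : ℂ) 1).tendsto_subseq
    (x := fun n : ℕ => u ^ n) (fun n => by simp [hu])
  have hv' := hv.comp (tendsto_add_atTop_nat 1)
  have h0 := (hv'.sub hv).norm
  rw [sub_self, norm_zero] at h0
  obtain ⟨n, hn⟩ := (h0.eventually (gt_mem_nhds hη)).exists
  have hlt := hφ (Nat.lt_succ_self n)
  refine ⟨φ (n + 1) - φ n, Nat.sub_pos_of_lt hlt, ?_⟩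
  have e : u ^ φ (n + 1) - u ^ φ n = u ^ φ n * (u ^ (φ (n + 1) - φ n) - 1) := by
    rw [mul_sub, ← pow_add, Nat.add_sub_cancel' hlt.le, mul_one]
  simp only [Function.comp_apply] at hn
  rw [e, norm_mul, norm_pow, hu, one_pow, one_mul] at hn
  exact hn

/-- The matrix `!![1, s; 0, 1]`. -/
def shear (s : ℂ) : SL(2, ℂ) := ⟨!![1, s; 0, 1], by simp⟩

theorem IsDiscreteUpToSign.exists_shear {H : Subgroup SL(2, ℂ)} (hH : IsDiscreteUpToSign H) :
    ∃ δ > 0, ∀ s : ℂ, ‖s‖ < δ → shear s ∈ H → s = 0 := by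
  have hc : Tendsto shear (𝓝 0) (𝓝 1) := by
    rw [tendsto_iff]
    intro i j
    fin_cases i <;> fin_cases j <;> simp [shear]; exact tendsto_id
  obtain ⟨δ, hδ, h⟩ := Metric.eventually_nhds_iff.1 (hc.eventually hH)
  refine ⟨δ, hδ, fun s hs hsH => ?_⟩
  have := h (by simpa using hs) hsH
  rcases this with h | h
  · simpa [shear] using congrArg (fun M : SL(2, ℂ) => M 0 1) h
  · simpa [shear] using congrArg (fun M : SL(2, ℂ) => M 0 1) h

/-- If a discrete group contains a parabolic fixing `∞` and a further element fixing `∞`, then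
the derivative of the latter at `∞` is a root of unity. -/
theorem abelianByFinite_of_parabolic {H : Subgroup SL(2, ℂ)} (hH : IsDiscreteUpToSign H)
    {M N : SL(2, ℂ)} (hM : M ∈ H) (hN : N ∈ H) (hMu : M ∈ unipotentSubgroup) (hM01 : M 0 1 ≠ 0)
    (hN10 : N 1 0 = 0) : AbelianByFinite M N := by
  obtain ⟨δ, hδ, hs⟩ := hH.exists_shear
  have hNdet := det_eq_one' N
  rw [hN10, mul_zero, sub_zero] at hNdet
  have h11 := eq_of_mem_unipotentSubgroup hMu
  obtain ⟨hM10, hM00⟩ := hMu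
  -- the squares of the conjugates of `M` by elements fixing `∞`
  have hconj {X : SL(2, ℂ)} (hX : X 1 0 = 0) :
      (X * M * X⁻¹) ^ 2 = shear (2 * X 0 0 ^ 2 * (M 0 0 * M 0 1)) := by
    obtain ⟨k1, k2, k3, k4⟩ := conj_apply X M
    have hXdet := det_eq_one' X
    rw [hX, mul_zero, sub_zero] at hXdet
    rw [pow_two, ext_iff']
    simp only [mul_apply (X * M * X⁻¹), k1, k2, k3, k4, hX, h11, hM10, hXdet]
    simp only [shear]
    refine ⟨?_, ?_, ?_, ?_⟩ <;> simp <;> first | linear_combination hM00 | ring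
  have hpow (X : SL(2, ℂ)) (hX : X 1 0 = 0) (n : ℕ) :
      (X ^ n) 1 0 = 0 ∧ (X ^ n) 0 0 = X 0 0 ^ n := by
    induction n with
    | zero => simp
    | succ n ih => rw [pow_succ, mul_apply, mul_apply, ih.1, ih.2, hX]; simp [pow_succ]
  have hm : M 0 0 * M 0 1 ≠ 0 := mul_ne_zero (fun h => by simp [h] at hM00) hM01
  -- an element that contracts at `∞` would conjugate `M` into small parabolics
  have hge {X : SL(2, ℂ)} (hXH : X ∈ H) (hX : X 1 0 = 0) (hX0 : X 0 0 ≠ 0) : 1 ≤ ‖X 0 0‖ := by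
    by_contra! hlt
    have h0 : Tendsto (fun n : ℕ => ‖2 * (X 0 0 ^ n) ^ 2 * (M 0 0 * M 0 1)‖) atTop (𝓝 0) := by
      have := (((tendsto_pow_atTop_nhds_zero_of_norm_lt_one hlt).pow 2).const_mul 2).mul_const
        (M 0 0 * M 0 1)
      simpa using this.norm
    obtain ⟨n, hn⟩ := (h0.eventually (gt_mem_nhds hδ)).exists
    have := hs _ hn (by
      rw [← (hpow X hX n).2, ← hconj (hpow X hX n).1]
      have := H.pow_mem hXH n
      exact H.pow_mem (H.mul_mem (H.mul_mem this hM) (H.inv_mem this)) 2)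
    rw [mul_eq_zero, mul_eq_zero, pow_eq_zero_iff two_ne_zero] at this
    exact (this.resolve_right hm).elim (by norm_num) (pow_ne_zero n hX0)
  obtain ⟨k1, k2, k3, k4⟩ := inv_apply N
  have hN00 : N 0 0 ≠ 0 := left_ne_zero_of_mul_eq_one hNdet
  have hN11 : N 1 1 ≠ 0 := right_ne_zero_of_mul_eq_one hNdet
  have hnorm : ‖N 0 0‖ = 1 := by
    have h1 := hge hN hN10 hN00
    have h2 := hge (H.inv_mem hN) (by rw [k3, hN10, neg_zero]) (by rwa [k1])
    rw [k1] at h2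
    have := congrArg norm hNdet
    rw [norm_mul, norm_one] at this
    nlinarith
  have hm2 : 0 < ‖2 * (M 0 0 * M 0 1)‖ := norm_pos_iff.2 (mul_ne_zero two_ne_zero hm)
  obtain ⟨k, hk, hkδ⟩ := exists_norm_pow_sub_one_lt (u := N 0 0 ^ 2)
    (by rw [norm_pow, hnorm, one_pow])
    (η := δ / ‖2 * (M 0 0 * M 0 1)‖) (div_pos hδ hm2)
  have hroot : (N 0 0 ^ k) ^ 2 = 1 := by
    have e : shear (2 * ((N 0 0 ^ k) ^ 2 - 1) * (M 0 0 * M 0 1))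
        = (N ^ k * M * (N ^ k)⁻¹) ^ 2 * ((1 * M * 1⁻¹) ^ 2)⁻¹ := by
      rw [hconj (hpow N hN10 k).1, hconj (by simp), eq_mul_inv_iff_mul_eq, ext_iff',
        (hpow N hN10 k).2]
      simp only [mul_apply]
      simp [shear]
      ring
    have := hs (2 * ((N 0 0 ^ k) ^ 2 - 1) * (M 0 0 * M 0 1)) ?_ ?_
    · rw [mul_eq_zero, mul_eq_zero] at this
      exact sub_eq_zero.1 ((this.resolve_right hm).resolve_left two_ne_zero)
    · rw [lt_div_iff₀ hm2, ← norm_mul] at hkδ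
      have e' : 2 * ((N 0 0 ^ k) ^ 2 - 1) * (M 0 0 * M 0 1)
          = ((N 0 0 ^ 2) ^ k - 1) * (2 * (M 0 0 * M 0 1)) := by ring
      rwa [e']
    · rw [e]
      have hNk := H.pow_mem hN k
      have h1 : (1 * M * 1⁻¹ : SL(2, ℂ)) ∈ H := by simpa using hM
      exact H.mul_mem (H.pow_mem (H.mul_mem (H.mul_mem hNk hM) (H.inv_mem hNk)) 2)
        (H.inv_mem (H.pow_mem h1 2))
  have hnorm' (X : SL(2, ℂ)) (hX : X 1 0 = 0) (Y : SL(2, ℂ)) (hY : Y ∈ unipotentSubgroup) :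
      X * Y * X⁻¹ ∈ unipotentSubgroup := by
    obtain ⟨c1, -, c3, -⟩ := conj_apply X Y
    have hXdet := det_eq_one' X
    rw [hX, mul_zero, sub_zero] at hXdet
    rw [mem_unipotentSubgroup, c1, c3, hX, hY.1, hXdet]
    simpa using hY.2
  refine ⟨unipotentSubgroup, ?_, ⟨hM10, hM00⟩, fun X hX => ⟨hnorm' N hN10 X hX, ?_⟩, k, hk, ?_⟩
  · intro X hX Y hY
    have eX := eq_of_mem_unipotentSubgroup hX
    have eY := eq_of_mem_unipotentSubgroup hY
    rw [ext_iff']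
    simp only [mul_apply, eX, eY, hX.1, hY.1]
    refine ⟨?_, ?_, ?_, ?_⟩ <;> ring
  · have := hnorm' N⁻¹ (by rw [k3, hN10, neg_zero]) X hX
    rwa [inv_inv] at this
  · rw [mem_unipotentSubgroup, (hpow N hN10 k).1, (hpow N hN10 k).2]
    exact ⟨rfl, hroot⟩

/-- Jørgensen's inequality for a parabolic matrix `M` (the lemma of Shimizu). -/
theorem jorgensen_parabolic {H : Subgroup SL(2, ℂ)} (hH : IsDiscreteUpToSign H) {M N : SL(2, ℂ)}
    (hM : M ∈ H) (hN : N ∈ H) (hMu : M ∈ unipotentSubgroup) (hM01 : M 0 1 = M 0 0)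
    (h : ‖N 1 0‖ < 1 / 4) : AbelianByFinite M N := by
  have h11 := eq_of_mem_unipotentSubgroup hMu
  have hM10 := hMu.1
  have hM00 := hMu.2
  have hε : ‖M 0 0‖ = 1 := by
    have := congrArg norm hM00
    rwa [norm_pow, norm_one, pow_eq_one_iff_of_nonneg (norm_nonneg _) two_ne_zero] at this
  have hne : M 0 0 ≠ 0 := by
    rw [← norm_ne_zero_iff, hε]; exact one_ne_zero
  set ε := M 0 0 with hεdef
  set F := iterConj M N with hF
  have hrec (n : ℕ) :
      F (n + 1) 0 0 = ε * (1 - F n 0 0 * F n 1 0) ∧ F (n + 1) 0 1 = ε * F n 0 0 ^ 2 ∧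
      F (n + 1) 1 0 = -(ε * F n 1 0 ^ 2) ∧ F (n + 1) 1 1 = ε * (1 + F n 0 0 * F n 1 0) := by
    obtain ⟨k1, k2, k3, k4⟩ := conj_apply (F n) M
    have hdet := det_eq_one' (F n)
    change (F n * M * (F n)⁻¹) 0 0 = _ ∧ (F n * M * (F n)⁻¹) 0 1 = _ ∧ (F n * M * (F n)⁻¹) 1 0 = _ ∧
      (F n * M * (F n)⁻¹) 1 1 = _
    rw [k1, k2, k3, k4, h11, hM10, hM01]
    refine ⟨?_, ?_, ?_, ?_⟩
    · linear_combination ε * hdet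
    · ring
    · ring
    · linear_combination ε * hdet
  have hc (n : ℕ) : ‖F n 1 0‖ ≤ (1 / 4) ^ (n + 1) := by
    induction n with
    | zero => rw [zero_add, pow_one]; exact h.le
    | succ n ih =>
      rw [(hrec n).2.2.1, norm_neg, norm_mul, hε, one_mul, norm_pow, pow_succ _ (n + 1), pow_two]
      refine mul_le_mul ih (ih.trans ?_) (norm_nonneg _) (by positivity)
      exact pow_le_of_le_one (by norm_num) (by norm_num) (Nat.succ_ne_zero n)
  have ha (n : ℕ) : ‖F n 0 0‖ ≤ ‖N 0 0‖ + 2 := by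
    induction n with
    | zero => exact le_add_of_nonneg_right zero_le_two
    | succ n ih =>
      rw [(hrec n).1, norm_mul, hε, one_mul]
      have h1 : ‖F n 1 0‖ ≤ 1 / 4 :=
        (hc n).trans (pow_le_of_le_one (by norm_num) (by norm_num) (Nat.succ_ne_zero n))
      have h2 := norm_sub_le 1 (F n 0 0 * F n 1 0)
      rw [norm_one, norm_mul] at h2
      have h3 : ‖F n 0 0‖ * ‖F n 1 0‖ ≤ (‖N 0 0‖ + 2) * (1 / 4) := by gcongr
      linarith [norm_nonneg (N 0 0)]
  have hc0 : Tendsto (fun n => F n 1 0) atTop (𝓝 0) := by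
    refine squeeze_zero_norm hc ?_
    exact (tendsto_pow_atTop_nhds_zero_of_lt_one (by norm_num : (0 : ℝ) ≤ 1 / 4)
      (by norm_num)).comp (tendsto_add_atTop_nat 1)
  have hac : Tendsto (fun n => F n 0 0 * F n 1 0) atTop (𝓝 0) := by
    refine squeeze_zero_norm (a := fun n => (‖N 0 0‖ + 2) * ‖F n 1 0‖) (fun n => ?_) ?_
    · rw [norm_mul]
      exact mul_le_mul_of_nonneg_right (ha n) (norm_nonneg _)
    · simpa using hc0.norm.const_mul (‖N 0 0‖ + 2)
  have ha1 : Tendsto (fun n => F (n + 1) 0 0) atTop (𝓝 ε) := by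
    simp only [fun n => (hrec n).1]
    simpa using (hac.const_sub 1).const_mul ε
  have hlim : Tendsto (fun n => F (n + 2)) atTop (𝓝 M) := by
    rw [tendsto_iff]
    intro i j
    fin_cases i <;> fin_cases j
    · exact ha1.comp (tendsto_add_atTop_nat 1)
    · simp only [Fin.zero_eta, Fin.mk_one, hM01, fun n => (hrec (n + 1)).2.1]
      have := (ha1.pow 2).const_mul ε
      rwa [hM00, mul_one] at this
    · simp only [Fin.zero_eta, Fin.mk_one, hM10]
      exact hc0.comp (tendsto_add_atTop_nat 2)
    · simp only [Fin.mk_one, h11, fun n => (hrec (n + 1)).2.2.2]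
      simpa using ((hac.comp (tendsto_add_atTop_nat 1)).const_add 1).const_mul ε
  obtain ⟨n, hn⟩ : ∃ n, F (n + 2) = M ∨ F (n + 2) = -M :=
    hH.exists_eq hM (fun n => iterConj_mem hM hN (n + 2)) hlim
  have hn0 : F (n + 2) 1 0 = 0 := by
    rcases hn with hn | hn <;> rw [hn] <;> simp [hM10]
  have hback (m : ℕ) (hm : F m 1 0 = 0) : N 1 0 = 0 := by
    induction m with
    | zero => exact hm
    | succ m ih =>
      apply ih
      rw [(hrec m).2.2.1] at hm
      simpa [hne] using hm
  exact abelianByFinite_of_parabolic hH hM hN hMu (by rw [hM01]; exact hne) (hback _ hn0)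

end SL2

/-! ### Jørgensen's inequality -/

namespace SL2

theorem exists_conj_upper (M : SL(2, ℂ)) : ∃ X : SL(2, ℂ), (X * M * X⁻¹) 1 0 = 0 := by
  by_cases hc : M 1 0 = 0
  · exact ⟨1, by simpa using hc⟩
  · -- move a fixed point `w` of `M` to `∞`
    obtain ⟨w, hw⟩ := exists_quadratic_eq_zero (a := M 1 0) (b := M 1 1 - M 0 0) (c := -M 0 1) hc
      (by obtain ⟨s, hs⟩ := IsAlgClosed.exists_pow_nat_eq
            (discrim (M 1 0) (M 1 1 - M 0 0) (-M 0 1)) two_pos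
          exact ⟨s, by rw [← hs, pow_two]⟩)
    obtain ⟨X, -, -, X3, X4⟩ : ∃ X : SL(2, ℂ), X 0 0 = 0 ∧ X 0 1 = -1 ∧ X 1 0 = 1 ∧ X 1 1 = -w :=
      ⟨⟨!![0, -1; 1, -w], by simp⟩, rfl, rfl, rfl, rfl⟩
    refine ⟨X, ?_⟩
    rw [(conj_apply X M).2.2.1, X3, X4]
    linear_combination hw

theorem exists_conj_diagonal {M : SL(2, ℂ)} (h : M 0 0 ≠ M 1 1) (hM : M 1 0 = 0) :
    ∃ X : SL(2, ℂ), X * M * X⁻¹ ∈ diagonalSubgroup ∧ (X * M * X⁻¹) 0 0 = M 0 0 ∧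
      (X * M * X⁻¹) 1 1 = M 1 1 := by
  refine ⟨shear (M 0 1 / (M 0 0 - M 1 1)), ?_⟩
  have h' := sub_ne_zero.2 h
  obtain ⟨k1, k2, k3, k4⟩ := conj_apply (shear (M 0 1 / (M 0 0 - M 1 1))) M
  rw [mem_diagonalSubgroup, k1, k2, k3, k4, hM]
  simp [shear]
  field_simp
  ring

theorem tr_commutator_diagonal {M : SL(2, ℂ)} (hM : M ∈ diagonalSubgroup) (N : SL(2, ℂ)) :
    tr (M * N * M⁻¹ * N⁻¹) - 2 = -((M 0 0 - M 1 1) ^ 2 * (N 0 1 * N 1 0)) := by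
  have h1 := det_eq_one' M
  have h2 := det_eq_one' N
  rw [tr_commutator]
  simp only [tr, mul_apply, hM.1, hM.2] at h1 ⊢
  linear_combination (4 - (N 0 0 + N 1 1) ^ 2) * h1 - (M 0 0 - M 1 1) ^ 2 * h2

theorem tr_sq_sub_four {M : SL(2, ℂ)} (hM : M 1 0 = 0) : tr M ^ 2 - 4 = (M 0 0 - M 1 1) ^ 2 := by
  have h1 := det_eq_one' M
  rw [hM] at h1
  rw [tr]
  linear_combination (4 : ℂ) * h1

theorem abelianByFinite_of_conj {X M N : SL(2, ℂ)}
    (h : AbelianByFinite (X * M * X⁻¹) (X * N * X⁻¹)) : AbelianByFinite M N := by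
  have := h.map (MulAut.conj X⁻¹).toMonoidHom
  simpa [mul_assoc] using this

theorem abelianByFinite_of_central {G : Type*} [Group G] {a : G} (ha : ∀ x, a * x = x * a) (b : G) :
    AbelianByFinite a b := by
  refine ⟨Subgroup.centralizer (Subgroup.centralizer {b} : Set G), ?_, ?_, ?_, 1, one_pos, ?_⟩
  · intro x hx y hy
    rw [Subgroup.mem_centralizer_iff] at hx hy
    refine (hx y ?_).symm
    rw [SetLike.mem_coe, Subgroup.mem_centralizer_singleton_iff]
    exact (hy b (Subgroup.mem_centralizer_singleton_iff.2 rfl)).symm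
  · rw [Subgroup.mem_centralizer_iff]
    exact fun x _ => (ha x).symm
  · intro x hx
    have hb := (Subgroup.mem_centralizer_iff.1 hx) b (Subgroup.mem_centralizer_singleton_iff.2 rfl)
    constructor
    · rwa [hb, mul_inv_cancel_right]
    · rwa [mul_assoc, ← hb, inv_mul_cancel_left]
  · rw [pow_one, Subgroup.mem_centralizer_iff]
    exact fun x hx => Subgroup.mem_centralizer_singleton_iff.1 hx

theorem tr_commutator_conj (X M N : SL(2, ℂ)) :
    tr (X * M * X⁻¹ * (X * N * X⁻¹) * (X * M * X⁻¹)⁻¹ * (X * N * X⁻¹)⁻¹)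
      = tr (M * N * M⁻¹ * N⁻¹) := by
  rw [← tr_conj X (M * N * M⁻¹ * N⁻¹)]
  congr 1
  group

/-- A form of Jørgensen's inequality, with a constant that is not sharp. -/
theorem jorgensen {H : Subgroup SL(2, ℂ)} (hH : IsDiscreteUpToSign H) {M N : SL(2, ℂ)}
    (hM : M ∈ H) (hN : N ∈ H) (h : ‖tr M ^ 2 - 4‖ + ‖tr (M * N * M⁻¹ * N⁻¹) - 2‖ < 1 / 16) :
    AbelianByFinite M N := by
  wlog hup : M 1 0 = 0 generalizing H M N
  · obtain ⟨X, hX⟩ := exists_conj_upper M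
    apply abelianByFinite_of_conj (X := X)
    refine this (hH.conj X) (Subgroup.mem_map_of_mem _ hM) (Subgroup.mem_map_of_mem _ hN) ?_ hX
    rwa [tr_conj, tr_commutator_conj]
  rcases ne_or_eq (M 0 0) (M 1 1) with hne | heq
  · obtain ⟨X, hX, hX0, hX1⟩ := exists_conj_diagonal hne hup
    apply abelianByFinite_of_conj (X := X)
    refine jorgensen_diagonal (hH.conj X) (Subgroup.mem_map_of_mem _ hM)
      (Subgroup.mem_map_of_mem _ hN) hX (by rwa [hX0, hX1]) ?_
    have e1 := tr_commutator_diagonal hX (X * N * X⁻¹)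
    rw [tr_commutator_conj] at e1
    rw [e1, tr_sq_sub_four hup, hX0, hX1, norm_neg, norm_mul] at h
    rw [hX0, hX1, mul_add, mul_one, ← norm_pow]
    exact h
  · have hdet := det_eq_one' M
    have hu : M ∈ unipotentSubgroup := ⟨hup, by
      rw [hup, mul_zero, sub_zero, ← heq] at hdet
      rw [pow_two, hdet]⟩
    have h00 : M 0 0 ≠ 0 := fun h0 => by simpa [h0] using hu.2
    by_cases h01 : M 0 1 = 0
    · apply abelianByFinite_of_central
      intro x
      rw [ext_iff']
      simp only [mul_apply, h01, hup, ← heq]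
      refine ⟨?_, ?_, ?_, ?_⟩ <;> ring
    · obtain ⟨r, hr⟩ := IsAlgClosed.exists_pow_nat_eq (M 0 0 / M 0 1) two_pos
      have hr0 : r ≠ 0 := by
        rintro rfl
        rw [zero_pow two_ne_zero] at hr
        exact div_ne_zero h00 h01 hr.symm
      obtain ⟨X, hX⟩ : ∃ X : SL(2, ℂ), X 0 0 = r ∧ X 0 1 = 0 ∧ X 1 0 = 0 ∧ X 1 1 = r⁻¹ :=
        ⟨⟨!![r, 0; 0, r⁻¹], by simp [hr0]⟩, rfl, rfl, rfl, rfl⟩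
      obtain ⟨X1, X2, X3, X4⟩ := hX
      obtain ⟨k1, k2, k3, k4⟩ := conj_apply X M
      have m0 : (X * M * X⁻¹) 0 0 = M 0 0 := by rw [k1, X1, X2, X3, X4]; field_simp; ring
      have m1 : (X * M * X⁻¹) 0 1 = M 0 0 := by rw [k2, X1, X2, hr]; field_simp; ring
      have m2 : (X * M * X⁻¹) 1 0 = 0 := by rw [k3, X3, hup]; ring
      have m3 : (X * M * X⁻¹) 1 1 = M 0 0 := by
        rw [k4, X1, X2, X3, X4, ← heq]; field_simp; ring
      apply abelianByFinite_of_conj (X := X)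
      refine jorgensen_parabolic (hH.conj X) (Subgroup.mem_map_of_mem _ hM)
        (Subgroup.mem_map_of_mem _ hN) ⟨m2, by rw [m0]; exact hu.2⟩ (by rw [m0, m1]) ?_
      have e : tr (M * N * M⁻¹ * N⁻¹) - 2 = (X * N * X⁻¹) 1 0 ^ 2 := by
        rw [← tr_commutator_conj X, tr_commutator]
        have h1 := det_eq_one' (X * N * X⁻¹)
        generalize X * N * X⁻¹ = Y at *
        generalize X * M * X⁻¹ = Z at *
        simp only [tr, mul_apply, m0, m1, m2, m3]
        linear_combination (4 + (Y 0 0 + Y 1 1 + Y 1 0) ^ 2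
          - 2 * (Y 0 0 + Y 1 1) * (Y 0 0 + Y 1 1 + Y 1 0)) * hu.2
      rw [e, norm_pow] at h
      have := norm_nonneg (tr M ^ 2 - 4)
      nlinarith [norm_nonneg ((X * N * X⁻¹) 1 0)]

end SL2

/-! ### The four traces -/

namespace SL2

/-- The trace estimate behind `jorgensen_of_traces`, with `2 + e`, `2 + f`, `w` in place of the
traces of `M`, `N` and `M N`: the commutator has trace close to `2`. -/
theorem norm_fricke_lt {e f w : ℂ} (he : ‖e‖ < 1 / 2000) (hf : ‖f‖ < 1 / 2000)
    (h1 : ‖w‖ < 2 + 1 / 1000) (h2 : ‖(2 + e) * (2 + f) - w‖ < 2 + 1 / 1000) :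
    ‖(2 + e) ^ 2 + (2 + f) ^ 2 + w ^ 2 - (2 + e) * (2 + f) * w - 4‖ < 1 / 20 := by
  -- the numbers `w` and `(2 + e) * (2 + f) - w` have norm about `2` and sum about `4`,
  -- so both are about `2`
  have hg : ‖2 * e + 2 * f + e * f‖ < 3 / 1000 := by
    have i1 := norm_add₃_le (a := 2 * e) (b := 2 * f) (c := e * f)
    simp only [norm_mul, Complex.norm_ofNat] at i1
    nlinarith [norm_nonneg e, norm_nonneg f]
  have hre : 2 - 4 / 1000 < w.re := by
    have i1 := Complex.re_le_norm ((2 + e) * (2 + f) - w)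
    have i2 : ((2 + e) * (2 + f) - w).re = 4 + (2 * e + 2 * f + e * f).re - w.re := by
      simp; ring
    have i3 := Complex.abs_re_le_norm (2 * e + 2 * f + e * f)
    have i4 := neg_abs_le (2 * e + 2 * f + e * f).re
    linarith
  obtain ⟨h, rfl⟩ : ∃ h, w = 2 + h := ⟨w - 2, by ring⟩
  have hh : ‖h‖ < 15 / 100 := by
    have i1 : ‖2 + h‖ ^ 2 = 4 + 4 * h.re + ‖h‖ ^ 2 := by
      simp only [← Complex.normSq_eq_norm_sq, Complex.normSq_apply]
      simp; ring
    simp at hre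
    nlinarith [norm_nonneg (2 + h), norm_nonneg h]
  have key : (2 + e) ^ 2 + (2 + f) ^ 2 + (2 + h) ^ 2 - (2 + e) * (2 + f) * (2 + h) - 4
      = h * h + (e * e + f * f - 2 * (e * f) - (2 * e + 2 * f + e * f) * h) := by ring
  rw [key]
  have j1 := norm_add_le (h * h) (e * e + f * f - 2 * (e * f) - (2 * e + 2 * f + e * f) * h)
  have j2 := norm_sub_le (e * e + f * f - 2 * (e * f)) ((2 * e + 2 * f + e * f) * h)
  have j3 := norm_sub_le (e * e + f * f) (2 * (e * f))
  have j4 := norm_add_le (e * e) (f * f)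
  simp only [norm_mul, Complex.norm_ofNat] at j1 j2 j3 j4 hg
  have := norm_nonneg e
  have := norm_nonneg f
  have := norm_nonneg h
  have := norm_nonneg (2 * e + 2 * f + e * f)
  have b1 : ‖h‖ * ‖h‖ ≤ 15 / 100 * (15 / 100) := by gcongr
  have b2 : ‖e‖ * ‖e‖ ≤ 1 / 2000 * (1 / 2000) := by gcongr
  have b3 : ‖f‖ * ‖f‖ ≤ 1 / 2000 * (1 / 2000) := by gcongr
  have b4 : ‖e‖ * ‖f‖ ≤ 1 / 2000 * (1 / 2000) := by gcongr
  have b5 : ‖2 * e + 2 * f + e * f‖ * ‖h‖ ≤ 3 / 1000 * (15 / 100) := by gcongr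
  linarith

theorem exists_sign_of_sq_near {x : ℂ} (h : ‖x ^ 2 - 4‖ < 1 / 1000) :
    ∃ e : ℂ, ‖e‖ < 1 / 2000 ∧ (x = 2 + e ∨ x = -(2 + e)) := by
  have h1 : ‖x - 2‖ * ‖x + 2‖ < 1 / 1000 := by
    rw [← norm_mul]
    convert h using 2
    ring
  have h2 : 4 ≤ ‖x - 2‖ + ‖x + 2‖ := by
    have := norm_sub_le (x + 2) (x - 2)
    have e : x + 2 - (x - 2) = 4 := by ring
    rw [e, Complex.norm_ofNat] at this
    linarith
  have := norm_nonneg (x - 2)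
  have := norm_nonneg (x + 2)
  rcases le_total ‖x - 2‖ ‖x + 2‖ with hle | hle
  · exact ⟨x - 2, by nlinarith, Or.inl (by ring)⟩
  · refine ⟨-(x + 2), by rw [norm_neg]; nlinarith, Or.inr (by ring)⟩

/-- If the squared traces of `M` and `N` are close to `4` and the traces of `M N` and `M N⁻¹` are
not much larger than `2` then the trace of the commutator is close to `2`: this is the place where
all four traces are used. -/
theorem jorgensen_of_traces {H : Subgroup SL(2, ℂ)} (hH : IsDiscreteUpToSign H) {M N : SL(2, ℂ)}
    (hM : M ∈ H) (hN : N ∈ H) (h1 : ‖tr M ^ 2 - 4‖ < 1 / 1000) (h2 : ‖tr N ^ 2 - 4‖ < 1 / 1000)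
    (h3 : ‖tr (M * N)‖ < 2 + 1 / 1000) (h4 : ‖tr (M * N⁻¹)‖ < 2 + 1 / 1000) :
    AbelianByFinite M N := by
  apply jorgensen hH hM hN
  suffices ‖tr (M * N * M⁻¹ * N⁻¹) - 2‖ < 1 / 20 by linarith
  rw [tr_commutator]
  rw [tr_mul_inv] at h4
  obtain ⟨e, he, hx⟩ := exists_sign_of_sq_near h1
  obtain ⟨f, hf, hy⟩ := exists_sign_of_sq_near h2
  generalize tr (M * N) = z at *
  rcases hx with hx | hx <;> rcases hy with hy | hy <;> rw [hx, hy] at h4 ⊢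
  · convert norm_fricke_lt he hf h3 h4 using 2
    ring
  · rw [← norm_neg] at h3 h4
    have i : (2 + e) * (2 + f) - -z = -((2 + e) * -(2 + f) - z) := by ring
    rw [← i] at h4
    convert norm_fricke_lt he hf h3 h4 using 2
    ring
  · rw [← norm_neg] at h3 h4
    have i : (2 + e) * (2 + f) - -z = -(-(2 + e) * (2 + f) - z) := by ring
    rw [← i] at h4
    convert norm_fricke_lt he hf h3 h4 using 2
    ring
  · convert norm_fricke_lt he hf h3 (by convert h4 using 2; ring) using 2
    ring

/-- A discrete group of isometries lifts to a group of matrices that is discrete up to sign. -/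
theorem isDiscreteUpToSign_comap {G : Subgroup (H3 ≃ᵢ H3)} (hG : DiscreteTopology G) :
    IsDiscreteUpToSign (G.comap Moebius.toIsom) := by
  have h1 : ∀ᶠ g in 𝓝 (1 : H3 ≃ᵢ H3), g ∈ G → g = 1 := by
    have h0 : ({1} : Set G) ∈ 𝓝 (1 : G) := by simp [nhds_discrete]
    obtain ⟨V, hV, hV'⟩ := mem_nhds_subtype (G : Set (H3 ≃ᵢ H3)) 1 _ |>.1 h0
    filter_upwards [hV] with g hg hgG
    exact congrArg Subtype.val (hV' (show (⟨g, hgG⟩ : G) ∈ _ from hg))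
  have h2 := Moebius.continuous_toIsom.tendsto 1
  rw [map_one] at h2
  filter_upwards [h2.eventually h1] with M hM hMG
  exact (Moebius.toIsom_eq_one_iff M).1 (hM hMG)

end SL2

namespace Moebius

open SL2

theorem not_isElementary_imp {A B : H3 ≃ᵢ H3} (hd : DiscreteTopology (Subgroup.closure {A, B}))
    (hne : ¬ IsElementary (Subgroup.closure {A, B})) :
    ∃ C : H3 ≃ᵢ H3, (C = A ∨ C = B ∨ C = A * B ∨ C = A * B⁻¹) ∧
      C ∉ nearUnipotent (1 / 1000) := by
  by_contra! hcon
  obtain ⟨M, hA, hM⟩ := hcon A (Or.inl rfl)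
  obtain ⟨N, hB, hN⟩ := hcon B (Or.inr (Or.inl rfl))
  obtain ⟨P, hP, hP'⟩ := hcon (A * B) (Or.inr (Or.inr (Or.inl rfl)))
  obtain ⟨Q, hQ, hQ'⟩ := hcon (A * B⁻¹) (Or.inr (Or.inr (Or.inr rfl)))
  apply hne
  have key {X Y : SL(2, ℂ)} (h : toIsom X = toIsom Y) (hY : ‖tr Y ^ 2 - 4‖ < 1 / 1000) :
      ‖tr X‖ < 2 + 1 / 1000 := by
    have e : ‖tr X ^ 2 - 4‖ < 1 / 1000 := by
      rcases (toIsom_eq_iff X Y).1 h with rfl | rfl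
      · exact hY
      · rwa [tr_neg, neg_sq]
    have := norm_add_le (tr X ^ 2 - 4) 4
    rw [sub_add_cancel, norm_pow, Complex.norm_ofNat] at this
    nlinarith [norm_nonneg (tr X)]
  have hABF : AbelianByFinite M N := by
    refine jorgensen_of_traces (isDiscreteUpToSign_comap hd) ?_ ?_ hM hN ?_ ?_
    · rw [Subgroup.mem_comap, ← hA]
      exact Subgroup.subset_closure (by simp)
    · rw [Subgroup.mem_comap, ← hB]
      exact Subgroup.subset_closure (by simp)
    · exact key (by rw [map_mul, ← hA, ← hB, hP]) hP'
    · exact key (by rw [map_mul, map_inv, ← hA, ← hB, hQ]) hQ'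
  have := (hABF.map toIsom).isElementary
  rwa [← hA, ← hB] at this

/-- The four isometries `A`, `B`, `A B`, `A B⁻¹` are not all conjugate to small ones. -/
theorem exists_nhds_not_all_small : ∃ U ∈ 𝓝 (1 : H3 ≃ᵢ H3), ∀ A B : H3 ≃ᵢ H3,
    DiscreteTopology (Subgroup.closure {A, B}) → ¬ IsElementary (Subgroup.closure {A, B}) →
      ∃ C : H3 ≃ᵢ H3, (C = A ∨ C = B ∨ C = A * B ∨ C = A * B⁻¹) ∧
        ∀ h : H3 ≃ᵢ H3, h * C * h⁻¹ ∉ U := by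
  refine ⟨nearUnipotent (1 / 1000), nearUnipotent_mem_nhds (by norm_num), fun A B hd hne => ?_⟩
  obtain ⟨C, hC, hCU⟩ := not_isElementary_imp hd hne
  refine ⟨C, hC, fun h hmem => hCU ?_⟩
  have := conj_mem_nearUnipotent hmem h⁻¹
  simpa [mul_assoc] using this

/-- An upper triangular matrix with diagonal entries `a`, `d` moves every point by at least
`|log |a / d||`. -/
theorem le_cosh_dist_act {M : SL(2, ℂ)} (hM : M 1 0 = 0) (x : H3) :
    ‖M 0 0‖ ^ 2 + ‖M 1 1‖ ^ 2 ≤ 2 * Real.cosh (dist x (act M x)) := by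
  have hdet := det_eq_one' M
  rw [hM, mul_zero, sub_zero] at hdet
  have h1 : ‖M 0 0‖ * ‖M 1 1‖ = 1 := by rw [← norm_mul, hdet, norm_one]
  have hx := x.pos
  have ht : (act M x).t = x.t / ‖M 1 1‖ ^ 2 := by simp [act, hM]
  have hd : 0 < ‖M 1 1‖ := by
    refine norm_pos_iff.2 (right_ne_zero_of_mul_eq_one hdet)
  have h0 : ‖M 0 0‖ = 1 / ‖M 1 1‖ := by field_simp; linarith
  rw [H3.cosh_dist, ht, h0]
  have hz := sq_nonneg ‖x.z - (act M x).z‖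
  have hpos : 0 < 2 * x.t * (x.t / ‖M 1 1‖ ^ 2) := by positivity
  have : 2 * (1 + (0 + (x.t - x.t / ‖M 1 1‖ ^ 2) ^ 2) / (2 * x.t * (x.t / ‖M 1 1‖ ^ 2)))
      = (1 / ‖M 1 1‖) ^ 2 + ‖M 1 1‖ ^ 2 := by
    field_simp
    ring
  rw [← this]
  gcongr

theorem exists_conj_of_translationLength {M : SL(2, ℂ)} {ε : ℝ} (hε : 0 < ε)
    (h : translationLength (toIsom M) ≤ ε) :
    ∃ X : SL(2, ℂ), (X * M * X⁻¹) 1 0 = 0 ∧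
      ‖(X * M * X⁻¹) 0 0‖ ^ 2 + ‖(X * M * X⁻¹) 1 1‖ ^ 2 ≤ 2 * Real.cosh (2 * ε) := by
  obtain ⟨X, hX⟩ := exists_conj_upper M
  refine ⟨X, hX, ?_⟩
  have : Nonempty H3 := ⟨H3.base⟩
  obtain ⟨x, hx⟩ := exists_lt_of_ciInf_lt (show (⨅ x : H3, dist x (toIsom M x)) < 2 * ε from
    lt_of_le_of_lt h (by linarith))
  refine (le_cosh_dist_act hX (act X x)).trans ?_
  rw [← act_mul, inv_mul_cancel_right, act_mul, dist_act]
  refine mul_le_mul_of_nonneg_left ?_ zero_le_two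
  rw [Real.cosh_le_cosh, abs_of_nonneg dist_nonneg, abs_of_nonneg (by positivity)]
  exact hx.le

end Moebius

/-! ### Small translation lengths -/

namespace SL2

open Filter

/-- Uniformly near the unit circle, some even power of a complex number is close to `1`. -/
theorem exists_pow_near_one_of_annulus {η : ℝ} (hη : 0 < η) : ∃ ρ > 0, ∀ z : ℂ, |‖z‖ - 1| < ρ →
    ∃ k : ℕ, 0 < k ∧ ‖(z ^ 2) ^ k - 1‖ < η := by
  obtain ⟨δ, hδ, h⟩ := (isCompact_sphere (0 : ℂ) 1).exists_thickening_subset_open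
    (t := ⋃ k : ℕ, {z : ℂ | 0 < k ∧ ‖(z ^ 2) ^ k - 1‖ < η})
    (isOpen_iUnion fun k => by
      by_cases hk : 0 < k
      · simp only [hk, true_and]
        exact isOpen_lt (by fun_prop) continuous_const
      · simp [hk])
    (fun z hz => by
      rw [mem_sphere_zero_iff_norm] at hz
      obtain ⟨k, hk⟩ := exists_norm_pow_sub_one_lt (u := z ^ 2) (by rw [norm_pow, hz, one_pow]) hη
      exact Set.mem_iUnion.2 ⟨k, hk⟩)
  refine ⟨min δ 1, by positivity, fun z hz => ?_⟩
  have hz0 : 0 < ‖z‖ := by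
    have := (abs_lt.1 (hz.trans_le (min_le_right _ _))).1
    linarith
  have hmem : z ∈ Metric.thickening δ (Metric.sphere (0 : ℂ) 1) := by
    rw [Metric.mem_thickening_iff]
    refine ⟨z / ‖z‖, by simp [hz0.ne'], ?_⟩
    have hzC : (‖z‖ : ℂ) ≠ 0 := Complex.ofReal_ne_zero.2 hz0.ne'
    have e : z - z / ‖z‖ = z / ‖z‖ * ((‖z‖ - 1 : ℝ) : ℂ) := by
      push_cast
      field_simp
    rw [dist_eq_norm, e, norm_mul, Complex.norm_real, Real.norm_eq_abs, norm_div, Complex.norm_real,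
      norm_norm, div_self hz0.ne', one_mul]
    exact hz.trans_le (min_le_left _ _)
  simpa using h hmem

theorem diagonal_pow {M : SL(2, ℂ)} (hM : M ∈ diagonalSubgroup) (k : ℕ) :
    (M ^ k) 0 0 = M 0 0 ^ k ∧ (M ^ k) 1 1 = M 1 1 ^ k := by
  induction k with
  | zero => simp
  | succ k ih => simp [pow_succ, mul_apply, hM.1, hM.2, ih.1, ih.2]

/-- If some even power of an eigenvalue of `M` is close to `1`, while the squared trace of `M` is
not close to `4`, then Jørgensen's inequality applies to the corresponding power of `M`. -/
theorem exists_pow_of_trace_far {H : Subgroup SL(2, ℂ)} (hH : IsDiscreteUpToSign H) {M N : SL(2, ℂ)}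
    (hM : M ∈ H) (hN : N ∈ H) (h1 : 1 / 1000 ≤ ‖tr M ^ 2 - 4‖)
    (h2 : ‖tr (M * N * M⁻¹ * N⁻¹) - 2‖ ≤ 60) {X : SL(2, ℂ)} (hX : (X * M * X⁻¹) 1 0 = 0)
    {k : ℕ} (hk : ‖((X * M * X⁻¹) 0 0 ^ 2) ^ k - 1‖ < 1 / 2000) :
    AbelianByFinite (M ^ k) N := by
  have hne : (X * M * X⁻¹) 0 0 ≠ (X * M * X⁻¹) 1 1 := by
    intro h
    rw [← tr_conj X M, tr_sq_sub_four hX, h, sub_self] at h1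
    norm_num at h1
  obtain ⟨Y, hY, hY0, hY1⟩ := exists_conj_diagonal hne hX
  have e : Y * (X * M * X⁻¹) * Y⁻¹ = Y * X * M * (Y * X)⁻¹ := by group
  rw [e] at hY hY0 hY1
  rw [← hY0] at hk
  generalize Y * X = Z at *
  clear hY0 hY1 e hne hX X Y
  apply jorgensen hH (H.pow_mem hM k) hN
  rw [← tr_conj Z, ← tr_commutator_conj Z, ← conj_pow]
  rw [← tr_conj Z, tr_sq_sub_four hY.2] at h1
  rw [← tr_commutator_conj Z, tr_commutator_diagonal hY] at h2
  have hYk := Subgroup.pow_mem _ hY k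
  obtain ⟨p1, p2⟩ := diagonal_pow hY k
  rw [tr_commutator_diagonal hYk, tr_sq_sub_four hYk.2, p1, p2]
  have hdet := det_eq_one' (Z * M * Z⁻¹)
  rw [hY.2, mul_zero, sub_zero] at hdet
  generalize (Z * M * Z⁻¹) 0 0 = a at *
  generalize (Z * M * Z⁻¹) 1 1 = d at *
  generalize (Z * N * Z⁻¹) 0 1 * (Z * N * Z⁻¹) 1 0 = w at *
  rw [norm_neg, norm_mul, norm_pow] at h2 ⊢
  rw [norm_pow] at h1
  have hk2 : ‖a ^ k - d ^ k‖ ^ 2 ≤ 1 / 1000000 := by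
    have hak : a ^ k * d ^ k = 1 := by rw [← mul_pow, hdet, one_pow]
    have e1 : (a ^ 2) ^ k - 1 = a ^ k * (a ^ k - d ^ k) := by
      rw [← pow_mul, mul_comm 2 k, pow_mul, mul_sub, hak, pow_two]
    rw [e1, norm_mul] at hk
    have e2 : a ^ k * a ^ k = 1 + a ^ k * (a ^ k - d ^ k) := by rw [mul_sub, hak]; ring
    have i2 := norm_sub_norm_le 1 (-(a ^ k * (a ^ k - d ^ k)))
    rw [sub_neg_eq_add, ← e2, norm_neg, norm_mul, norm_mul, norm_one] at i2
    have ha : 1 / 2 ≤ ‖a ^ k‖ := by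
      by_contra! hlt
      nlinarith [norm_nonneg (a ^ k)]
    have : ‖a ^ k - d ^ k‖ ≤ 1 / 1000 := by
      by_contra! hlt
      nlinarith
    calc ‖a ^ k - d ^ k‖ ^ 2 ≤ (1 / 1000) ^ 2 := by gcongr
      _ = _ := by norm_num
  have hw : ‖w‖ ≤ 60000 := by
    by_contra! hlt
    nlinarith [norm_nonneg w]
  have : ‖a ^ k - d ^ k‖ ^ 2 * ‖w‖ ≤ 1 / 1000000 * 60000 := by gcongr
  linarith

/-- If `a` and `d` are the eigenvalues of a matrix of determinant one, then the bound on
`‖a‖ ^ 2 + ‖d‖ ^ 2` that a small translation length provides keeps `a` near the unit circle and the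
trace `a + d` not much larger than `2`. -/
theorem norm_bounds {a d : ℂ} (had : a * d = 1) {ρ : ℝ} (hρ : 0 < ρ)
    (h : ‖a‖ ^ 2 + ‖d‖ ^ 2 < 2 + ρ ^ 2) : |‖a‖ - 1| < ρ ∧ ‖a + d‖ ^ 2 < 4 + ρ ^ 2 := by
  have h1 : ‖a‖ * ‖d‖ = 1 := by rw [← norm_mul, had, norm_one]
  have ha := norm_nonneg a
  have hd := norm_nonneg d
  constructor
  · have h2 : |‖a‖ - ‖d‖| < ρ := abs_lt_of_sq_lt_sq (by nlinarith) hρ.le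
    rw [abs_lt] at h2 ⊢
    constructor
    · rcases le_total 1 ‖d‖ with hd1 | hd1
      · linarith
      · nlinarith
    · rcases le_total 1 ‖d‖ with hd1 | hd1
      · nlinarith
      · linarith
  · have := norm_add_le a d
    nlinarith [norm_nonneg (a + d)]

end SL2

namespace Moebius

open SL2

/-- If the translation lengths of the four isometries `A`, `B`, `B A`, `B⁻¹ A` are all small, and
the group is discrete, then some powers of `A` and `B` commute. The products are in the order in
which products of paths are composed in the fundamental group. -/
theorem exists_pos_commute_pow : ∃ ε : ℝ, 0 < ε ∧ ∀ (G : Subgroup (H3 ≃ᵢ H3)), DiscreteTopology G →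
    ∀ M N : SL(2, ℂ), toIsom M ∈ G → toIsom N ∈ G →
      translationLength (toIsom M) ≤ ε → translationLength (toIsom N) ≤ ε →
      translationLength (toIsom (N * M)) ≤ ε → translationLength (toIsom (N⁻¹ * M)) ≤ ε →
      ∃ k m : ℕ, 0 < k ∧ 0 < m ∧ Commute (toIsom M ^ k) (toIsom N ^ m) := by
  obtain ⟨ρ₀, hρ₀, hann⟩ := exists_pow_near_one_of_annulus (η := 1 / 2000) (by norm_num)
  obtain ⟨ρ, hρ, hle, hle'⟩ : ∃ ρ : ℝ, 0 < ρ ∧ ρ ≤ ρ₀ ∧ ρ ≤ 1 / 1000 :=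
    ⟨min ρ₀ (1 / 1000), by positivity, min_le_left _ _, min_le_right _ _⟩
  obtain ⟨ε, hε, hcosh⟩ : ∃ ε : ℝ, 0 < ε ∧ 2 * Real.cosh (2 * ε) < 2 + ρ ^ 2 := by
    have hc : Filter.Tendsto (fun ε : ℝ => 2 * Real.cosh (2 * ε)) (𝓝[>] 0) (𝓝 2) := by
      have : Continuous fun ε : ℝ => 2 * Real.cosh (2 * ε) :=
        continuous_const.mul (Real.continuous_cosh.comp (continuous_const.mul continuous_id))
      simpa using (this.tendsto 0).mono_left nhdsWithin_le_nhds
    have h1 := hc.eventually (gt_mem_nhds (lt_add_of_pos_right 2 (pow_pos hρ 2)))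
    obtain ⟨ε, h2, h3⟩ := (h1.and self_mem_nhdsWithin).exists
    exact ⟨ε, h3, h2⟩
  refine ⟨ε, hε, fun G hG M N hM hN h1 h2 h3 h4 => ?_⟩
  -- the eigenvalues are close to the unit circle, and the traces not much larger than `2`
  have key {Y : SL(2, ℂ)} (hY : translationLength (toIsom Y) ≤ ε) :
      ‖tr Y‖ < 2 + 1 / 1000 ∧ ∃ X : SL(2, ℂ), (X * Y * X⁻¹) 1 0 = 0 ∧
        ∃ k : ℕ, 0 < k ∧ ‖((X * Y * X⁻¹) 0 0 ^ 2) ^ k - 1‖ < 1 / 2000 := by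
    obtain ⟨X, hX, hX'⟩ := exists_conj_of_translationLength hε hY
    have hdet := det_eq_one' (X * Y * X⁻¹)
    rw [hX, mul_zero, sub_zero] at hdet
    obtain ⟨b1, b2⟩ := norm_bounds hdet hρ (lt_of_le_of_lt hX' hcosh)
    refine ⟨?_, X, hX, hann _ (b1.trans_le hle)⟩
    have e : tr Y = (X * Y * X⁻¹) 0 0 + (X * Y * X⁻¹) 1 1 := (tr_conj X Y).symm
    rw [e]
    nlinarith
  obtain ⟨t1, X, hX, k, hk, hXk⟩ := key h1
  obtain ⟨t2, Y, hY, l, hl, hYl⟩ := key h2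
  obtain ⟨t3, -⟩ := key h3
  obtain ⟨t4, -⟩ := key h4
  rw [tr_mul_comm] at t3 t4
  have hH := isDiscreteUpToSign_comap hG
  have hcomm : ‖tr (M * N * M⁻¹ * N⁻¹) - 2‖ ≤ 60 := by
    rw [tr_commutator]
    have i1 := norm_add_le (tr M ^ 2 + tr N ^ 2) (tr (M * N) ^ 2)
    have i2 := norm_add_le (tr M ^ 2) (tr N ^ 2)
    have i3 := norm_sub_le (tr M ^ 2 + tr N ^ 2 + tr (M * N) ^ 2 - tr M * tr N * tr (M * N)) 4
    have i4 := norm_sub_le (tr M ^ 2 + tr N ^ 2 + tr (M * N) ^ 2) (tr M * tr N * tr (M * N))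
    have e : tr M ^ 2 + tr N ^ 2 + tr (M * N) ^ 2 - tr M * tr N * tr (M * N) - 2 - 2
        = tr M ^ 2 + tr N ^ 2 + tr (M * N) ^ 2 - tr M * tr N * tr (M * N) - 4 := by ring
    rw [e]
    simp only [norm_mul, norm_pow, Complex.norm_ofNat] at i1 i2 i3 i4
    have b1 : ‖tr M‖ ^ 2 ≤ 3 ^ 2 := by gcongr; linarith
    have b2 : ‖tr N‖ ^ 2 ≤ 3 ^ 2 := by gcongr; linarith
    have b3 : ‖tr (M * N)‖ ^ 2 ≤ 3 ^ 2 := by gcongr; linarith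
    have b4 : ‖tr M‖ * ‖tr N‖ * ‖tr (M * N)‖ ≤ 2.1 * 2.1 * 2.1 := by
      gcongr <;> linarith
    linarith
  rcases lt_or_ge ‖tr M ^ 2 - 4‖ (1 / 1000) with hM4 | hM4
  · rcases lt_or_ge ‖tr N ^ 2 - 4‖ (1 / 1000) with hN4 | hN4
    · obtain ⟨m, hm, hc⟩ :=
        ((jorgensen_of_traces hH (M := M) (N := N) hM hN hM4 hN4 t3 t4).map toIsom).commute_pow
      exact ⟨1, m, one_pos, hm, by rwa [pow_one]⟩
    · have hcomm' : ‖tr (N * M * N⁻¹ * M⁻¹) - 2‖ ≤ 60 := by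
        convert hcomm using 3
        rw [tr_commutator, tr_commutator, tr_mul_comm N M]
        ring
      obtain ⟨m, hm, hc⟩ :=
        ((exists_pow_of_trace_far hH (M := N) (N := M) hN hM hN4 hcomm' hY hYl).map
          toIsom).commute_pow
      exact ⟨m, l, hm, hl, by rw [map_pow] at hc; exact hc.symm⟩
  · obtain ⟨m, hm, hc⟩ :=
      ((exists_pow_of_trace_far hH (M := M) (N := N) hM hN hM4 hcomm hX hXk).map toIsom).commute_pow
    exact ⟨k, m, hk, hm, by rwa [map_pow] at hc⟩

end Moebius

/-! ### Axes of hyperbolic isometries of the plane -/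

namespace HypPlane

open SL2

/-- For a hyperbolic matrix `P` this form vanishes exactly on the axis of `P`. -/
def axisForm (P : SL(2, ℝ)) (z : ℍ) : ℝ :=
  P 1 0 * (z.re ^ 2 + z.im ^ 2) + (P 1 1 - P 0 0) * z.re - P 0 1

theorem smul_mul_denom (P : SL(2, ℝ)) (z : ℍ) :
    ((P • z : ℍ) : ℂ) * (P 1 0 * z + P 1 1) = P 0 0 * z + P 0 1 ∧ (P 1 0 * z + P 1 1 : ℂ) ≠ 0 := by
  have hne : (P 1 0 * z + P 1 1 : ℂ) ≠ 0 := by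
    intro h
    have him := congrArg Complex.im h
    have hre := congrArg Complex.re h
    simp at him hre
    have hc : P 1 0 = 0 := him.resolve_right z.im_pos.ne'
    rw [hc] at hre
    have hdet := det_eq_one' P
    simp at hre
    simp [hc, hre] at hdet
  refine ⟨?_, hne⟩
  rw [UpperHalfPlane.specialLinearGroup_apply]
  simp only [Algebra.algebraMap_self, RingHom.id_apply]
  rw [div_mul_cancel₀ _ hne]

/-- The displacement of a point under `P`, in terms of its position relative to the axis. -/
theorem sinh_half_dist_smul (P : SL(2, ℝ)) (z : ℍ) :
    4 * z.im ^ 2 * Real.sinh (dist z (P • z) / 2) ^ 2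
      = axisForm P z ^ 2 + z.im ^ 2 * (tr P ^ 2 - 4) := by
  obtain ⟨h, hne⟩ := smul_mul_denom P z
  have hdet := det_eq_one' P
  have hy := z.im_pos
  have hy' := (P • z).im_pos
  have hn : 0 < Complex.normSq (P 1 0 * z + P 1 1) := Complex.normSq_pos.2 hne
  have him : (P • z).im * Complex.normSq (P 1 0 * z + P 1 1) = z.im := by
    have e : ((P • z : ℍ) : ℂ) * Complex.normSq (P 1 0 * z + P 1 1)
        = (P 0 0 * z + P 0 1) * conj (P 1 0 * z + P 1 1 : ℂ) := by
      rw [← h, ← Complex.mul_conj]; ring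
    have := congrArg Complex.im e
    rw [Complex.im_mul_ofReal] at this
    simp at this
    rw [this]
    linear_combination z.im * hdet
  rw [UpperHalfPlane.sinh_half_dist, div_pow, mul_pow, Real.sq_sqrt (by positivity), dist_eq_norm]
  have e : (z : ℂ) - (P • z : ℍ) =
      (P 1 0 * z ^ 2 + (P 1 1 - P 0 0) * z - P 0 1) / (P 1 0 * z + P 1 1) := by
    rw [eq_div_iff hne]
    linear_combination -h
  rw [e, norm_div, div_pow, ← Complex.normSq_eq_norm_sq, ← Complex.normSq_eq_norm_sq]
  have e2 : Complex.normSq (P 1 0 * (z : ℂ) ^ 2 + (P 1 1 - P 0 0) * z - P 0 1)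
      = axisForm P z ^ 2 + z.im ^ 2 * (tr P ^ 2 - 4) := by
    simp only [Complex.normSq_apply, axisForm, tr, pow_two]
    simp
    linear_combination (-4 * z.im ^ 2 : ℝ) * hdet
  rw [e2]
  generalize Complex.normSq (P 1 0 * z + P 1 1) = n at *
  rw [← him]
  field_simp
  ring

theorem axisForm_sq (P : SL(2, ℝ)) (z : ℍ) : axisForm (P * P) z = tr P * axisForm P z := by
  simp only [axisForm, mul_apply, tr]; ring

theorem tr_sq (P : SL(2, ℝ)) : tr (P * P) = tr P ^ 2 - 2 := by
  have hdet := det_eq_one' P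
  simp only [mul_apply, tr]
  linear_combination (-2 : ℝ) * hdet

/-- An isometry that translates a geodesic is hyperbolic, and the geodesic is its axis. -/
theorem axisForm_eq_zero {P : SL(2, ℝ)} {c : ℝ → ℍ} (hc : Isometry c) {l : ℝ} (hl : 0 < l)
    (h : ∀ t, P • c t = c (t + l)) : 4 < tr P ^ 2 ∧ ∀ t, axisForm P (c t) = 0 := by
  have key (t : ℝ) : 4 < tr P ^ 2 ∧ axisForm P (c t) = 0 := by
    have e1 := sinh_half_dist_smul P (c t)
    have e2 := sinh_half_dist_smul (P * P) (c t)
    rw [axisForm_sq, tr_sq, mul_smul, h, h, hc.dist_eq, Real.dist_eq] at e2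
    rw [h, hc.dist_eq, Real.dist_eq] at e1
    have l1 : |t - (t + l)| = l := by rw [sub_add_cancel_left, abs_neg, abs_of_pos hl]
    have l2 : |t - (t + l + l)| = 2 * l := by
      rw [show t - (t + l + l) = -(2 * l) by ring, abs_neg, abs_of_pos (by positivity)]
    rw [l1] at e1
    rw [l2, mul_div_assoc, Real.sinh_two_mul] at e2
    have hy := (c t).im_pos
    have hs : 0 < Real.sinh (l / 2) := Real.sinh_pos_iff.2 (by positivity)
    have hch := Real.cosh_sq (l / 2)
    generalize Real.sinh (l / 2) = s at *
    generalize Real.cosh (l / 2) = C at *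
    generalize (c t).im = y at *
    generalize tr P = x at *
    generalize axisForm P (c t) = q at *
    have e3 : (4 * y ^ 2 * s ^ 2) * (4 * C ^ 2 - x ^ 2) = 0 := by
      linear_combination e2 - x ^ 2 * e1
    have hx : x ^ 2 = 4 * C ^ 2 := by
      rcases mul_eq_zero.1 e3 with h0 | h0
      · exact absurd h0 (by positivity)
      · linarith
    refine ⟨by rw [hx, hch]; nlinarith [pow_pos hs 2], ?_⟩
    have hq : q ^ 2 = 0 := by
      rw [hx, hch] at e1
      linear_combination -e1
    simpa using hq
  exact ⟨(key 0).1, fun t => (key t).2⟩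

/-- `SL(2, ℝ)` acts on the hyperbolic plane with kernel `±1`. -/
theorem eq_or_eq_neg_of_smul {P Q : SL(2, ℝ)} (h : ∀ z : ℍ, P • z = Q • z) : P = Q ∨ P = -Q := by
  have key (X : SL(2, ℝ)) (hX : ∀ z : ℍ, X • z = z) : X = 1 ∨ X = -1 := by
    have h1 := (smul_mul_denom X UpperHalfPlane.I).1
    have h2 := (smul_mul_denom X (UpperHalfPlane.mk (2 * Complex.I) (by simp))).1
    have hdet := det_eq_one' X
    rw [hX] at h1 h2
    have a1 := congrArg Complex.re h1
    have a2 := congrArg Complex.im h1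
    have a3 := congrArg Complex.re h2
    simp at a1 a2 a3
    have hc : X 1 0 = 0 := by linarith
    have hb : X 0 1 = 0 := by linarith
    rw [hc, a2] at hdet
    have : (X 0 0 - 1) * (X 0 0 + 1) = 0 := by linear_combination hdet
    rcases mul_eq_zero.1 this with h0 | h0
    · left
      rw [ext_iff']
      simp [hb, hc, a2, sub_eq_zero.1 h0]
    · right
      rw [ext_iff']
      simp [hb, hc, a2, eq_neg_of_add_eq_zero_left h0]
  have := key (P * Q⁻¹) fun z => by rw [mul_smul, h, smul_inv_smul]
  simpa [mul_inv_eq_iff_eq_mul] using this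

/-- Commuting hyperbolic isometries have the same axis. -/
theorem axisForm_eq_zero_of_commute {P Q : SL(2, ℝ)} (h : ∀ z : ℍ, P • Q • z = Q • P • z)
    (hQ : 4 < tr Q ^ 2) {z : ℍ} (hz : axisForm Q z = 0) : axisForm P z = 0 := by
  have hPQ : P * Q = Q * P := by
    rcases eq_or_eq_neg_of_smul (P := P * Q) (Q := Q * P) (fun z => by rw [mul_smul, mul_smul, h])
      with h' | h'
    · exact h'
    · exfalso
      have e : P * Q * P⁻¹ = -Q := by rw [h', neg_mul, mul_inv_cancel_right]
      have := congrArg tr e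
      rw [tr_conj, tr_neg] at this
      nlinarith
  rw [ext_iff'] at hPQ
  simp only [mul_apply] at hPQ
  obtain ⟨e1, e2, e3, -⟩ := hPQ
  have hdet := det_eq_one' Q
  have hQ' : 0 < (Q 1 1 - Q 0 0) ^ 2 + 4 * (Q 0 1 * Q 1 0) := by
    rw [tr] at hQ
    linarith
  have hmul : ((Q 1 1 - Q 0 0) ^ 2 + 4 * (Q 0 1 * Q 1 0)) * axisForm P z = 0 := by
    simp only [axisForm] at hz ⊢
    linear_combination ((Q 1 1 - Q 0 0) * (P 1 1 - P 0 0) + 4 * Q 0 1 * P 1 0) * hz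
      - (Q 1 1 - Q 0 0) * (z.re ^ 2 + z.im ^ 2) * e3 - (Q 1 1 - Q 0 0) * e2
      + 4 * Q 0 1 * z.re * e3 - 4 * Q 0 1 * e1
  exact (mul_eq_zero.1 hmul).resolve_left hQ'.ne'

/-- Three points on a circle and on a line are not distinct. -/
theorem eq_of_circle_of_line {L₁ L₂ k u v : ℝ} (hL : L₁ ≠ 0 ∨ L₂ ≠ 0) {x y : Fin 3 → ℝ} {r : ℝ}
    (hline : ∀ i, L₁ * x i + L₂ * y i = k)
    (hcirc : ∀ i, x i ^ 2 + y i ^ 2 - 2 * u * x i - 2 * v * y i = r) :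
    (x 1 = x 0 ∧ y 1 = y 0) ∨ (x 2 = x 0 ∧ y 2 = y 0) ∨ (x 1 = x 2 ∧ y 1 = y 2) := by
  have hn : 0 < L₁ ^ 2 + L₂ ^ 2 := by
    rcases hL with h | h <;> positivity
  have par (i : Fin 3) : ∃ τ : ℝ, x i = x 0 - L₂ * τ ∧ y i = y 0 + L₁ * τ := by
    refine ⟨(-L₂ * (x i - x 0) + L₁ * (y i - y 0)) / (L₁ ^ 2 + L₂ ^ 2), ?_, ?_⟩
    · field_simp
      linear_combination L₁ * (hline i - hline 0)
    · field_simp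
      linear_combination L₂ * (hline i - hline 0)
  have hquad {i : Fin 3} {τ : ℝ} (h : x i = x 0 - L₂ * τ ∧ y i = y 0 + L₁ * τ) :
      τ = 0 ∨ τ * (L₁ ^ 2 + L₂ ^ 2) = 2 * (L₂ * (x 0 - u) - L₁ * (y 0 - v)) := by
    have e := hcirc i
    rw [h.1, h.2] at e
    have : τ * (τ * (L₁ ^ 2 + L₂ ^ 2) - 2 * (L₂ * (x 0 - u) - L₁ * (y 0 - v))) = 0 := by
      linear_combination e - hcirc 0
    exact (mul_eq_zero.1 this).imp id sub_eq_zero.1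
  obtain ⟨τ, h1⟩ := par 1
  obtain ⟨τ', h2⟩ := par 2
  rcases hquad h1 with h3 | h3
  · left; rw [h1.1, h1.2, h3]; simp
  · rcases hquad h2 with h4 | h4
    · right; left; rw [h2.1, h2.2, h4]; simp
    · right; right
      have : τ = τ' := mul_right_cancel₀ hn.ne' (h3.trans h4.symm)
      rw [h1.1, h1.2, h2.1, h2.2, this]
      exact ⟨rfl, rfl⟩

/-- A geodesic contained in the axis is all of the axis. -/
theorem mem_range_of_axisForm {P : SL(2, ℝ)} (hP : 4 < tr P ^ 2) {c : ℝ → ℍ} (hc : Isometry c)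
    (h : ∀ t, axisForm P (c t) = 0) {z : ℍ} (hz : axisForm P z = 0) : z ∈ Set.range c := by
  set s := dist z (c 0) with hs
  have h1 : dist (c s) (c 0) = s := by
    rw [hc.dist_eq, Real.dist_eq, sub_zero, abs_of_nonneg dist_nonneg]
  have h2 : dist (c (-s)) (c 0) = s := by
    rw [hc.dist_eq, Real.dist_eq, sub_zero, abs_neg, abs_of_nonneg dist_nonneg]
  set p : Fin 3 → ℍ := ![c s, z, c (-s)] with hp
  have hform (i : Fin 3) : axisForm P (p i) = 0 := by
    fin_cases i
    exacts [h s, hz, h (-s)]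
  have hdist (i : Fin 3) : dist (p i) (c 0) = s := by
    fin_cases i
    exacts [h1, rfl, h2]
  have hy := (c 0).im_pos
  have hcirc (i : Fin 3) : (p i).re ^ 2 + (p i).im ^ 2 - 2 * (c 0).re * (p i).re
      - 2 * ((c 0).im * Real.cosh s) * (p i).im = -((c 0).re ^ 2 + (c 0).im ^ 2) := by
    have e := UpperHalfPlane.cosh_dist (p i) (c 0)
    have hyi := (p i).im_pos
    rw [hdist, dist_eq_norm, ← Complex.normSq_eq_norm_sq, Complex.normSq_apply] at e
    simp only [Complex.sub_re, Complex.sub_im, UpperHalfPlane.coe_re, UpperHalfPlane.coe_im] at e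
    field_simp at e
    linear_combination -e
  have hdet := det_eq_one' P
  have hL : P 1 1 - P 0 0 + P 1 0 * (2 * (c 0).re) ≠ 0 ∨
      P 1 0 * (2 * ((c 0).im * Real.cosh s)) ≠ 0 := by
    by_contra! hcon
    have hc0 : P 1 0 = 0 := by
      have := Real.cosh_pos s
      rcases mul_eq_zero.1 hcon.2 with h0 | h0
      · exact h0
      · exact absurd h0 (by positivity)
    rw [hc0, zero_mul, add_zero] at hcon
    rw [hc0, mul_zero, sub_zero] at hdet
    rw [tr] at hP
    nlinarith [hcon.1]
  have := eq_of_circle_of_line hL (x := fun i => (p i).re) (y := fun i => (p i).im)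
    (k := P 0 1 + P 1 0 * ((c 0).re ^ 2 + (c 0).im ^ 2)) (fun i => by
      have e1 := hform i
      rw [axisForm] at e1
      linear_combination e1 - P 1 0 * hcirc i) hcirc
  rcases this with h0 | h0 | h0
  · exact ⟨s, (UpperHalfPlane.ext (Complex.ext h0.1 h0.2)).symm⟩
  · have e : c (-s) = c s := UpperHalfPlane.ext (Complex.ext h0.1 h0.2)
    have hs0 : s = 0 := by linarith [hc.injective e]
    exact ⟨0, (dist_eq_zero.1 (hs.symm.trans hs0)).symm⟩
  · exact ⟨-s, (UpperHalfPlane.ext (Complex.ext h0.1 h0.2)).symm⟩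

end HypPlane

/-! ### Lifting loops to the hyperbolic plane -/

namespace HyperbolicSurface

variable (S : HyperbolicSurface)

/-- The covering projection of a hyperbolic surface is a covering map whose fibers are the orbits
of the group. -/
theorem isQuotientCoveringMap : IsQuotientCoveringMap S.proj S.Γ := by
  have h1 : ContinuousConstSMul S.Γ ℍ := ⟨fun g => (g : ℍ ≃ᵢ ℍ).continuous⟩
  have h2 : IsCancelSMul S.Γ ℍ := by
    rw [isCancelSMul_iff_eq_one_of_smul_eq]
    intro g z hz
    exact Subtype.ext (S.free g g.2 z hz)
  have h3 : ProperlyDiscontinuousSMul S.Γ ℍ := by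
    refine ⟨fun {K L} hK hL => ?_⟩
    obtain ⟨r, hr⟩ := hK.isBounded.subset_closedBall UpperHalfPlane.I
    obtain ⟨r', hr'⟩ := hL.isBounded.subset_closedBall UpperHalfPlane.I
    have hfin := S.properlyDiscontinuous UpperHalfPlane.I (r + r')
    refine (hfin.preimage (f := fun g : S.Γ => (g : ℍ ≃ᵢ ℍ)) Subtype.val_injective.injOn).subset ?_
    rintro g ⟨_, ⟨x, hx, rfl⟩, hgx⟩
    refine ⟨g.2, ?_⟩
    have d1 := Metric.mem_closedBall.1 (hr hx)
    have d2 := Metric.mem_closedBall.1 (hr' hgx)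
    have d3 := dist_triangle_left UpperHalfPlane.I ((g : ℍ ≃ᵢ ℍ) UpperHalfPlane.I)
      ((g : ℍ ≃ᵢ ℍ) x)
    rw [(g : ℍ ≃ᵢ ℍ).dist_eq] at d3
    change dist ((g : ℍ ≃ᵢ ℍ) x) _ ≤ _ at d2
    linarith
  exact isQuotientCoveringMap_quotientMk_of_properlyDiscontinuousSMul

theorem isCoveringMap : IsCoveringMap S.proj := S.isQuotientCoveringMap.isCoveringMap

theorem proj_apply {g : ℍ ≃ᵢ ℍ} (hg : g ∈ S.Γ) (z : ℍ) : S.proj (g z) = S.proj z :=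
  S.isQuotientCoveringMap.map_smul ⟨g, hg⟩

theorem exists_of_proj_eq {z w : ℍ} (h : S.proj z = S.proj w) : ∃ g ∈ S.Γ, z = g w := by
  obtain ⟨g, hg⟩ := S.isQuotientCoveringMap.apply_eq_iff_mem_orbit.1 h
  exact ⟨g, g.2, hg.symm⟩

theorem ext_of_apply_eq {g h : ℍ ≃ᵢ ℍ} (hg : g ∈ S.Γ) (hh : h ∈ S.Γ) {z : ℍ} (e : g z = h z) :
    g = h := by
  refine (inv_mul_eq_one.1 (S.free (h⁻¹ * g) (S.Γ.mul_mem (S.Γ.inv_mem hh) hg) z ?_)).symm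
  change h.symm (g z) = z
  rw [e, h.symm_apply_apply]

/-- The lift of the path class `γ` to the hyperbolic plane that starts at `z` ends at `w`; in
particular `z` lies over `p` and `w` over `q`. -/
def LiftsTo {p q : S.Carrier} (γ : Path.Homotopic.Quotient p q) (z w : ℍ) : Prop :=
  ∃ (hz : S.proj z = p) (hw : S.proj w = q), S.isCoveringMap.monodromy γ ⟨z, hz⟩ = ⟨w, hw⟩

variable {S}

theorem LiftsTo.trans {p q r : S.Carrier} {γ : Path.Homotopic.Quotient p q}
    {δ : Path.Homotopic.Quotient q r} {x y z : ℍ} (h : S.LiftsTo γ x y) (h' : S.LiftsTo δ y z) :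
    S.LiftsTo (γ.trans δ) x z := by
  obtain ⟨hx, hy, h⟩ := h
  obtain ⟨_, hz, h'⟩ := h'
  exact ⟨hx, hz, by rw [IsCoveringMap.monodromy_trans_apply, h, h']⟩

theorem exists_liftsTo {p q : S.Carrier} (γ : Path.Homotopic.Quotient p q) {z : ℍ}
    (hz : S.proj z = p) : ∃ w, S.LiftsTo γ z w :=
  ⟨_, hz, _, rfl⟩

theorem LiftsTo.unique {p q : S.Carrier} {γ : Path.Homotopic.Quotient p q} {z w w' : ℍ}
    (h : S.LiftsTo γ z w) (h' : S.LiftsTo γ z w') : w = w' := by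
  obtain ⟨_, _, h⟩ := h
  obtain ⟨_, _, h'⟩ := h'
  exact congrArg Subtype.val (h.symm.trans h')

theorem liftsTo_of_path {z w : ℍ} (Γ : Path z w) {p q : S.Carrier} {γ : Path p q}
    (h : ∀ t, S.proj (Γ t) = γ t) : S.LiftsTo (Path.Homotopic.Quotient.mk γ) z w := by
  have hz : S.proj z = p := by have := h 0; simpa using this
  have hw : S.proj w = q := by have := h 1; simpa using this
  refine ⟨hz, hw, ?_⟩
  subst hz hw
  have e : γ = Γ.map S.isCoveringMap.continuous := by
    ext t
    exact (h t).symm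
  rw [e]
  exact S.isCoveringMap.monodromy_map (Path.Homotopic.Quotient.mk Γ)

theorem LiftsTo.smul {p q : S.Carrier} {γ : Path.Homotopic.Quotient p q} {z w : ℍ}
    (h : S.LiftsTo γ z w) {g : ℍ ≃ᵢ ℍ} (hg : g ∈ S.Γ) : S.LiftsTo γ (g z) (g w) := by
  obtain ⟨γ, rfl⟩ := Path.Homotopic.Quotient.mk_surjective γ
  obtain ⟨hz, hw, h⟩ := h
  have h0 : γ 0 = S.proj z := by rw [hz, γ.source]
  have h1 : S.isCoveringMap.liftPath γ z h0 1 = w := congrArg Subtype.val h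
  let Λ : Path z w := ⟨S.isCoveringMap.liftPath γ z h0, IsCoveringMap.liftPath_zero .., h1⟩
  have hΛ (t : I) : S.proj (Λ t) = γ t := congrFun (S.isCoveringMap.liftPath_lifts γ z h0) t
  refine liftsTo_of_path (Λ.map g.continuous) fun t => ?_
  rw [Path.map_coe, Function.comp_apply, S.proj_apply hg, hΛ]

theorem LiftsTo.symm {p q : S.Carrier} {γ : Path p q} {z w : ℍ}
    (h : S.LiftsTo (.mk γ) z w) : S.LiftsTo (.mk γ.symm) w z := by
  obtain ⟨hz, hw, h⟩ := h
  have h0 : γ 0 = S.proj z := by rw [hz, γ.source]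
  have h1 : S.isCoveringMap.liftPath γ z h0 1 = w := congrArg Subtype.val h
  let Λ : Path z w := ⟨S.isCoveringMap.liftPath γ z h0, IsCoveringMap.liftPath_zero .., h1⟩
  have hΛ (t : I) : S.proj (Λ t) = γ t := congrFun (S.isCoveringMap.liftPath_lifts γ z h0) t
  exact liftsTo_of_path Λ.symm fun t => hΛ _

/-- A loop that is freely homotopic to a closed geodesic acts on the hyperbolic plane as the
translation along a lift of this geodesic. -/
theorem exists_translation {p q : S.Carrier} {a : Path p p} {b : Path q q}
    (hb : S.IsClosedGeodesic b)
    (hab : FreelyHomotopic a b) {z : ℍ} (hz : S.proj z = p) :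
    ∃ g ∈ S.Γ, ∃ c : ℝ → ℍ, ∃ l : ℝ, Isometry c ∧ 0 < l ∧ (∀ t, g (c t) = c (t + l)) ∧
      S.LiftsTo (.mk a) z (g z) ∧ Set.range b = S.proj '' Set.range c := by
  obtain ⟨c, l, hc, hl, hper, hbc⟩ := hb
  obtain ⟨d, hd⟩ := hab
  -- the covering transformation `h` that translates `c`
  obtain ⟨h, hh, hcl⟩ := S.exists_of_proj_eq (hper 0)
  have hhc (t : ℝ) : h (c t) = c (t + l) := by
    have := S.isCoveringMap.eq_of_comp_eq (g₁ := fun t => h (c t)) (g₂ := fun t => c (t + l))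
      (h.continuous.comp hc.continuous) (hc.continuous.comp (by fun_prop))
      (funext fun t => by simp only [Function.comp_apply]; rw [S.proj_apply hh, hper]) 0 hcl.symm
    exact congrFun this t
  have hq : S.proj (c 0) = q := by simpa using (hbc 0).symm
  have hlb : S.LiftsTo (.mk b) (c 0) (h (c 0)) := by
    have hcont : Continuous fun t : I => c (l * t) := hc.continuous.comp (by fun_prop)
    refine liftsTo_of_path ⟨⟨fun t : I => c (l * t), hcont⟩, by simp, by simp [hhc]⟩ fun t => ?_
    exact (hbc t).symm
  -- transport along `d` to the base point `p`
  obtain ⟨w, hw⟩ := exists_liftsTo (.mk d.symm) hq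
  have hw' : S.LiftsTo (.mk d) w (c 0) := by simpa using hw.symm
  obtain ⟨hw0, -, -⟩ := hw'
  have hla : S.LiftsTo (.mk a) w (h w) := by
    obtain ⟨v, hv⟩ := exists_liftsTo (.mk a) hw0
    obtain ⟨hvp, hvp', -⟩ := id hv
    obtain ⟨u, hu⟩ := exists_liftsTo (.mk d) hvp'
    have h1 := (hw.trans hv).trans hu
    have h2 : ((Path.Homotopic.Quotient.mk d.symm).trans (.mk a)).trans (.mk d) = .mk b := by
      rw [← Path.Homotopic.Quotient.mk_trans, ← Path.Homotopic.Quotient.mk_trans]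
      exact Path.Homotopic.Quotient.eq.2 hd
    rw [h2] at h1
    have hu' : u = h (c 0) := h1.unique hlb
    have h3 : S.LiftsTo (.mk d.symm) u v := hu.symm
    rw [hu'] at h3
    rwa [h3.unique (hw.smul hh)] at hv
  -- move the lift to the given base point
  obtain ⟨k, hk, hzw⟩ := S.exists_of_proj_eq (hz.trans hw0.symm)
  refine ⟨k * h * k⁻¹, S.Γ.mul_mem (S.Γ.mul_mem hk hh) (S.Γ.inv_mem hk), fun t => k (c t), l,
    k.isometry.comp hc, hl, fun t => ?_, ?_, ?_⟩
  · change k (h (k.symm (k (c t)))) = _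
    rw [k.symm_apply_apply, hhc]
  · have := hla.smul hk
    rw [← hzw] at this
    convert this using 1
    change k (h (k.symm z)) = _
    rw [hzw, k.symm_apply_apply]
  · have hpk (t : ℝ) : S.proj (k (c t)) = S.proj (c t) := S.proj_apply hk _
    ext x
    constructor
    · rintro ⟨t, rfl⟩
      exact ⟨_, ⟨l * t, rfl⟩, by rw [hpk, hbc]⟩
    · rintro ⟨_, ⟨t, rfl⟩, rfl⟩
      have hmul : Function.Periodic (fun t => S.proj (c t)) l := hper
      refine ⟨⟨Int.fract (t / l), Int.fract_nonneg _, (Int.fract_lt_one _).le⟩, ?_⟩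
      have e : t = l * Int.fract (t / l) + ⌊t / l⌋ * l := by
        have := Int.fract_add_floor (t / l)
        field_simp at this
        linarith
      rw [hpk, hbc]
      conv_rhs => rw [e]
      exact (hmul.int_mul ⌊t / l⌋ _).symm

theorem LiftsTo.mul {p : S.Carrier} {γ δ : FundamentalGroup S.Carrier p} {z : ℍ} {g h : ℍ ≃ᵢ ℍ}
    (hg : S.LiftsTo γ.toPath z (g z)) (hh : S.LiftsTo δ.toPath z (h z)) (hΓ : h ∈ S.Γ) :
    S.LiftsTo (γ * δ).toPath z ((h * g) z) :=
  hh.trans (hg.smul hΓ)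

theorem LiftsTo.pow {p : S.Carrier} {γ : FundamentalGroup S.Carrier p} {z : ℍ} {g : ℍ ≃ᵢ ℍ}
    (hg : g ∈ S.Γ) (h : S.LiftsTo γ.toPath z (g z)) (hz : S.proj z = p) (k : ℕ) :
    S.LiftsTo (γ ^ k).toPath z ((g ^ k) z) := by
  induction k with
  | zero =>
    refine liftsTo_of_path (γ := Path.refl p) (Path.refl z) fun t => ?_
    simpa using hz
  | succ k ih =>
    rw [pow_succ, pow_succ']
    exact ih.mul h hg

/-- If positive powers of two loops commute then closed geodesics freely homotopic to them have
the same image. -/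
theorem range_eq_of_commute_pow {p q q' : S.Carrier} {α β : Path p p} {a : Path q q}
    {b : Path q' q'}
    (ha : S.IsClosedGeodesic a) (hαa : FreelyHomotopic α a)
    (hb : S.IsClosedGeodesic b) (hβb : FreelyHomotopic β b) {k m : ℕ} (hk : 0 < k) (hm : 0 < m)
    (hcomm : Commute (FundamentalGroup.fromPath (.mk α) ^ k)
      (FundamentalGroup.fromPath (.mk β) ^ m)) :
    Set.range a = Set.range b := by
  obtain ⟨z, hz⟩ := S.isQuotientCoveringMap.surjective p
  obtain ⟨g, hg, c, l, hc, hl, hgc, hgz, hra⟩ := exists_translation ha hαa hz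
  obtain ⟨g', hg', c', l', hc', hl', hgc', hgz', hrb⟩ := exists_translation hb hβb hz
  have hgk := S.Γ.pow_mem hg k
  have hgm := S.Γ.pow_mem hg' m
  -- the corresponding powers of the covering transformations commute
  have hpow := LiftsTo.pow (γ := FundamentalGroup.fromPath (.mk α)) hg hgz hz k
  have hpow' := LiftsTo.pow (γ := FundamentalGroup.fromPath (.mk β)) hg' hgz' hz m
  have h1 := hpow.mul hpow' hgm
  rw [hcomm.eq] at h1
  have hgg : g' ^ m * g ^ k = g ^ k * g' ^ m :=
    S.ext_of_apply_eq (S.Γ.mul_mem hgm hgk) (S.Γ.mul_mem hgk hgm) (h1.unique (hpow'.mul hpow hgk))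
  have htr {g : ℍ ≃ᵢ ℍ} {c : ℝ → ℍ} {l : ℝ} (h : ∀ t, g (c t) = c (t + l)) (n : ℕ) (t : ℝ) :
      (g ^ n) (c t) = c (t + n * l) := by
    induction n with
    | zero => simp
    | succ n ih =>
      rw [pow_succ']
      change g ((g ^ n) (c t)) = _
      rw [ih, h]
      congr 1
      push_cast
      ring
  obtain ⟨P, hP⟩ := S.orientation _ hgk
  obtain ⟨Q, hQ⟩ := S.orientation _ hgm
  obtain ⟨tP, aP⟩ := HypPlane.axisForm_eq_zero (P := P) hc (by positivity : 0 < k * l)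
    fun t => by rw [← hP, htr hgc]
  obtain ⟨tQ, aQ⟩ := HypPlane.axisForm_eq_zero (P := Q) hc' (by positivity : 0 < m * l')
    fun t => by rw [← hQ, htr hgc']
  have hPQ (z : ℍ) : P • Q • z = Q • P • z := by
    rw [← hP, ← hQ, ← hP, ← hQ]
    exact congrArg (fun f : ℍ ≃ᵢ ℍ => f z) hgg.symm
  -- both lifted geodesics are the common axis
  rw [hra, hrb]
  congr 1
  apply Set.Subset.antisymm
  · rintro _ ⟨t, rfl⟩
    exact HypPlane.mem_range_of_axisForm tQ hc' aQ
      (HypPlane.axisForm_eq_zero_of_commute (fun z => (hPQ z).symm) tP (aP t))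
  · rintro _ ⟨t, rfl⟩
    exact HypPlane.mem_range_of_axisForm tP hc aP
      (HypPlane.axisForm_eq_zero_of_commute hPQ tQ (aQ t))

end HyperbolicSurface

/-- The four curves `α`, `β`, `α β`, `α β⁻¹` are not all short. -/
theorem exists_pos_not_all_short : ∃ ε : ℝ, 0 < ε ∧
    ∀ (S : HyperbolicSurface) (p : S.Carrier) (α β : Path p p),
      S.IsGeometricIntersectionNumber α β 1 → ∀ N : MarkedHyperbolicManifold S p,
        ε < N.length α ∨ ε < N.length β ∨ ε < N.length (α.trans β) ∨
          ε < N.length (α.trans β.symm) := by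
  obtain ⟨ε, hε, h⟩ := Moebius.exists_pos_commute_pow
  refine ⟨ε, hε, fun S p α β hint N => ?_⟩
  by_contra! hcon
  obtain ⟨h1, h2, h3, h4⟩ := hcon
  obtain ⟨B, hB⟩ := Moebius.exists_toIsom_eq (N.orientation (FundamentalGroup.fromPath (.mk β)))
  obtain ⟨A, hA⟩ := Moebius.exists_toIsom_eq (N.orientation (FundamentalGroup.fromPath (.mk α)))
  -- the product `α.trans β` of paths is the product `β * α` in the fundamental group
  have e3 : N.ρ (FundamentalGroup.fromPath (.mk (α.trans β))) = Moebius.toIsom (B * A) := by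
    rw [map_mul, ← hB, ← hA, ← map_mul]
    rfl
  have e4 : N.ρ (FundamentalGroup.fromPath (.mk (α.trans β.symm))) = Moebius.toIsom (B⁻¹ * A) := by
    rw [map_mul, map_inv, ← hB, ← hA, ← map_inv, ← map_mul]
    rfl
  unfold MarkedHyperbolicManifold.length at h1 h2 h3 h4
  rw [hA] at h1
  rw [hB] at h2
  rw [e3] at h3
  rw [e4] at h4
  obtain ⟨k, m, hk, hm, hc⟩ := h N.ρ.range N.discrete A B (by rw [← hA]; exact ⟨_, rfl⟩)
    (by rw [← hB]; exact ⟨_, rfl⟩) h1 h2 h3 h4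
  rw [← hB, ← hA, ← map_pow, ← map_pow] at hc
  have hcomm := Commute.of_map N.faithful hc
  obtain ⟨q, q', a, b, ⟨-, ha, hαa⟩, ⟨-, hb, hβb⟩, hn⟩ := hint
  have hr := HyperbolicSurface.range_eq_of_commute_pow ha hαa hb hβb hk hm hcomm
  rcases hn with ⟨-, hn⟩ | ⟨hn, -⟩
  · exact one_ne_zero hn
  · exact hn hr

theorem proposition4p2 :
    (∃ U ∈ 𝓝 (1 : H3 ≃ᵢ H3), ∀ A B : H3 ≃ᵢ H3,
      DiscreteTopology (Subgroup.closure {A, B}) → ¬ IsElementary (Subgroup.closure {A, B}) →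
        ∃ C : H3 ≃ᵢ H3, (C = A ∨ C = B ∨ C = A * B ∨ C = A * B⁻¹) ∧
          ∀ h : H3 ≃ᵢ H3, h * C * h⁻¹ ∉ U) ∧
    (∃ ε : ℝ, 0 < ε ∧ ∀ (S : HyperbolicSurface) (p : S.Carrier) (α β : Path p p),
      IsSimpleLoop α → IsSimpleLoop β → Set.range α ∩ Set.range β = {p} →
      S.IsGeometricIntersectionNumber α β 1 →
        ∀ N : MarkedHyperbolicManifold S p,
          ε < N.length α ∨ ε < N.length β ∨
            ε < N.length (α.trans β) ∨ ε < N.length (α.trans β.symm)) := by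
  obtain ⟨ε, hε, h⟩ := exists_pos_not_all_short
  exact ⟨Moebius.exists_nhds_not_all_small, ε, hε, fun S p α β _ _ _ => h S p α β⟩
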